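/- Let $\mathfrak H$ be the upper half-plane and $\Gamma_1=\mathrm{SL}_2(\mathbb Z)$. For a lattice $L=[\omega_1,\omega_2]=\mathbb Z\omega_1+\mathbb Z\omega_2\subset\mathbb C$ put $$\sigma(z,L)=z\prod_{\omega\in L\setminus\{0\}}\Bigl(1-\frac z\omega\Bigr)e^{z/\omega+(z/\omega)^2/2},\qquad \zeta(z,L)=\frac{\sigma'(z,L)}{\sigma(z,L)},$$ let $\eta(\omega,L)$, for $\omega\in L$, be the constant with $\zeta(z+\omega,L)=\zeta(z,L)+\eta(\omega,L)$ for all $z\notin L$, and extend it to $\mathbb C$ by $\eta(r_1\omega_1+r_2\omega_2,L)=r_1\eta(\omega_1,L)+r_2\eta(\omega_2,L)$ for $r_1,r_2\in\mathbb R$. Let $\psi(z,L)=-1$ if $z\in L\setminus 2L$ and $\psi(z,L)=1$ otherwise. For $\tau\in\mathfrak H$, $z\in\mathbb C$ put $q=e^{2\pi i\tau}$, $\zeta=e^{2\pi iz}$, $\rho(\tau,z)=\exp(\tfrac12\eta(1,[\tau,1])z^2-\pi iz)$. For $k\in\mathbb Z$ and $\phi:\mathfrak H\times\mathbb C\to\mathbb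 C$ define $$(\phi|'_kM)(\tau,z)=(c\tau+d)^{-k}\phi\Bigl(\frac{a\tau+b}{c\tau+d},\frac z{c\tau+d}\Bigr),\qquad M=\begin{pmatrix}a&b\\c&d\end{pmatrix}\in\mathrm{SL}_2(\mathbb R),$$ $$(\phi|''_k[\lambda\ \mu])(\tau,z)=\Bigl(\psi(\lambda\tau+\mu,[\tau,1])\exp\bigl(\eta(\lambda\tau+\mu,[\tau,1])(z+\tfrac12(\lambda\tau+\mu))\bigr)\Bigr)^k\phi(\tau,z+\lambda\tau+\mu),\qquad(\lambda,\mu)\in\mathbb R^2.$$ For a subgroup $\Gamma\subset\Gamma_1$ of finite index, $J_k(\Gamma)$ is the set of modified Jacobi forms of weight $k$ and index $0$ on $\Gamma$: the holomorphic functions $\phi$ on $\mathfrak H\times\mathbb C$ such that (i) $\phi|'_kM=\phi$ for all $M\in\Gamma$; (ii) $\phi|''_kX=\phi$ for all $X\in\mathbb Z^2$; (iii) for each $M\in\Gamma_1$ the function $\rho^k(\phi|'_kM)$ has an absolutely convergent Fourier development $\sum_{n\ge0}\sum_{|r|\le r_0(n)}c(n,r)q^n\zeta^r$ for some (weakly)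 increasing sequence $(r_0(n))_{n\ge 0}$ of nonnegative integers with $r_0(n)/n\to0$. Theorem. For every $\tau\in\mathfrak H$ the product defining $\sigma(z,[\tau,1])$ converges for all $z\in\mathbb C$, and $\zeta(z+\omega,[\tau,1])=\zeta(z,[\tau,1])+\eta(\omega,[\tau,1])$ for all $\omega\in[\tau,1]$ and $z\notin[\tau,1]$. The function $\sigma(\tau,z):=\sigma(z,[\tau,1])$ belongs to $J_{-1}(\Gamma_1)$. Consequently the Klein forms $$\mathfrak k_{(\lambda,\mu)}(\tau)=\psi(\lambda\tau+\mu,[\tau,1])\exp\bigl(-\tfrac12\eta(\lambda\tau+\mu,[\tau,1])(\lambda\tau+\mu)\bigr)\sigma(\tau,\lambda\tau+\mu)$$ are its specializations: $\mathfrak k_{(\lambda,\mu)}(\tau)=(\sigma|''_{-1}[\lambda\ \mu])(\tau,0)$ for all $(\lambda,\mu)\in\mathbb R^2$; and if $(\lambda,\mu)\in N^{-1}\mathbb Z^2$ for an integer $N\ge1$, then $\mathfrak k_{(\lambda,\mu)}$ is a nearly holomorphic modular form (holomorphic on $\mathfrak H$ and meromorphic at every cusp) of weight $-1$ on the principal congruence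 subgroup $\Gamma(2N^2)$. -/

import Mathlib

open scoped UpperHalfPlane MatrixGroups ModularForm Manifold

noncomputable section

namespace ModifiedJacobi

/-- The `ω`-factor `(1 - z/ω) exp(z/ω + (z/ω)²/2)` of the Weierstrass product. -/
def sigmaFactor (z ω : ℂ) : ℂ :=
  (1 - z / ω) * Complex.exp (z / ω + (z / ω) ^ 2 / 2)

/-- The Weierstrass `σ`-function `σ(z, Λ)` of a lattice `Λ`. -/
def weierstrassSigma (Λ : Submodule ℤ ℂ) (z : ℂ) : ℂ :=
  z * ∏' ω : ↥((Λ : Set ℂ) \ {0}), sigmaFactor z ω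

/-- The Weierstrass `ζ`-function `ζ(z, Λ) = σ'(z, Λ) / σ(z, Λ)`. -/
def weierstrassZeta (Λ : Submodule ℤ ℂ) (z : ℂ) : ℂ :=
  deriv (weierstrassSigma Λ) z / weierstrassSigma Λ z

/-- For `ω ∈ Λ`, the constant `η(ω, Λ)` with `ζ(z + ω, Λ) = ζ(z, Λ) + η(ω, Λ)` for all `z ∉ Λ`. -/
def quasiPeriod (Λ : Submodule ℤ ℂ) (ω : ℂ) : ℂ :=
  Classical.epsilon fun c : ℂ =>
    ∀ z : ℂ, z ∉ Λ → weierstrassZeta Λ (z + ω) = weierstrassZeta Λ z + c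

/-- The Weierstrass `η`-function: the `ℝ`-linear extension of `ω ↦ η(ω, [ω₁, ω₂])` to `ℂ`, that is
`η(r₁ω₁ + r₂ω₂) = r₁ η(ω₁) + r₂ η(ω₂)`. -/
def weierstrassEta (L : PeriodPair) (z : ℂ) : ℂ :=
  (L.basis.repr z 0 : ℂ) * quasiPeriod L.lattice L.ω₁ +
    (L.basis.repr z 1 : ℂ) * quasiPeriod L.lattice L.ω₂

open Classical in
/-- `ψ(z, Λ)` is `-1` if `z ∈ Λ ∖ 2Λ` and `1` otherwise. -/
def psi (Λ : Submodule ℤ ℂ) (z : ℂ) : ℂ :=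
  if z ∈ Λ ∧ ¬ ∃ w ∈ Λ, z = 2 * w then -1 else 1

/-- The periods `τ, 1`, spanning the lattice `[τ, 1]`. -/
def periods (τ : ℍ) : PeriodPair where
  ω₁ := τ
  ω₂ := 1
  indep := by
    rw [LinearIndependent.pair_iff]
    intro s t h
    have h1 := congrArg Complex.im h
    have h2 := congrArg Complex.re h
    simp [τ.im_ne_zero] at h1
    subst h1
    simp at h2
    exact ⟨rfl, h2⟩

/-- `σ(τ, z) = σ(z, [τ, 1])`. -/
def sigma (τ : ℍ) (z : ℂ) : ℂ :=
  weierstrassSigma (periods τ).lattice z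

/-- `ρ(τ, z) = exp(½ η(1, [τ, 1]) z² - π i z)`. -/
def rho (τ : ℍ) (z : ℂ) : ℂ :=
  Complex.exp (1 / 2 * weierstrassEta (periods τ) 1 * z ^ 2 - Real.pi * Complex.I * z)

/-- The operator `φ |'_k M`, i.e. the index-zero Jacobi slash operator
`(cτ + d)^(-k) φ((aτ + b)/(cτ + d), z/(cτ + d))`. -/
def slash' (k : ℤ) (φ : ℍ → ℂ → ℂ) (M : SL(2, ℝ)) (τ : ℍ) (z : ℂ) : ℂ :=
  ((M 1 0 : ℂ) * τ + (M 1 1 : ℂ)) ^ (-k) * φ (M • τ) (z / ((M 1 0 : ℂ) * τ + (M 1 1 : ℂ)))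

/-- The operator `φ |''_k [a b]` for `(a, b) ∈ ℝ²`. -/
def slash'' (k : ℤ) (φ : ℍ → ℂ → ℂ) (a b : ℝ) (τ : ℍ) (z : ℂ) : ℂ :=
  (psi (periods τ).lattice (a * τ + b) *
      Complex.exp (weierstrassEta (periods τ) (a * τ + b) * (z + 1 / 2 * (a * τ + b)))) ^ k *
    φ τ (z + (a * τ + b))

/-- Joint holomorphy of a function on `ℍ × ℂ`. -/
def IsHolomorphic (φ : ℍ → ℂ → ℂ) : Prop :=
  DifferentiableOn ℂ (fun p : ℂ × ℂ => φ (UpperHalfPlane.ofComplex p.1) p.2)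
    {p : ℂ × ℂ | 0 < p.1.im}

/-- `f` has an (absolutely convergent) Fourier development
`∑_{n ≥ 0} ∑_{|r| ≤ r₀(n)} c(n, r) qⁿ ζʳ`, where `r₀` is an increasing sequence of nonnegative
integers with `r₀(n) / n → 0`, and `q = exp(2πiτ)`, `ζ = exp(2πiz)`. -/
def HasFourierDevelopment (f : ℍ → ℂ → ℂ) : Prop :=
  ∃ (r₀ : ℕ → ℕ) (c : ℕ → ℤ → ℂ),
    Monotone r₀ ∧
    Filter.Tendsto (fun n : ℕ => (r₀ n : ℝ) / (n : ℝ)) Filter.atTop (nhds 0) ∧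
    (∀ (n : ℕ) (r : ℤ), (r₀ n : ℤ) < |r| → c n r = 0) ∧
    ∀ (τ : ℍ) (z : ℂ),
      HasSum
        (fun p : ℕ × ℤ => c p.1 p.2 * Complex.exp (2 * Real.pi * Complex.I * τ) ^ p.1 *
          Complex.exp (2 * Real.pi * Complex.I * z) ^ p.2)
        (f τ z)

/-- Modified Jacobi forms of weight `k` and index `0` on a finite-index subgroup `Γ` of
`SL₂(ℤ)`. -/
structure IsModifiedJacobiForm (k : ℤ) (Γ : Subgroup SL(2, ℤ)) [Γ.FiniteIndex]
    (φ : ℍ → ℂ → ℂ) : Prop where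
  holomorphic : IsHolomorphic φ
  slash'_eq : ∀ M ∈ Γ, slash' k φ (M : SL(2, ℝ)) = φ
  slash''_eq : ∀ a b : ℤ, slash'' k φ a b = φ
  fourier : ∀ M : SL(2, ℤ),
    HasFourierDevelopment fun τ z => rho τ z ^ k * slash' k φ (M : SL(2, ℝ)) τ z

/-- The set `J_k(Γ)` of modified Jacobi forms. -/
def J (k : ℤ) (Γ : Subgroup SL(2, ℤ)) [Γ.FiniteIndex] : Set (ℍ → ℂ → ℂ) :=
  {φ | IsModifiedJacobiForm k Γ φ}

/-- The Klein form
`𝔨_(a,b)(τ) = ψ(a, b) exp(-½ η(aτ + b, [τ, 1]) (aτ + b)) σ(τ, aτ + b)`. -/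
def kleinForm (a b : ℝ) (τ : ℍ) : ℂ :=
  psi (periods τ).lattice (a * τ + b) *
    Complex.exp (-(1 / 2) * weierstrassEta (periods τ) (a * τ + b) * (a * τ + b)) *
    sigma τ (a * τ + b)

/-- Nearly holomorphic modular forms of weight `k` on `Γ`: holomorphic on `ℍ`, invariant under the
weight-`k` slash action of `Γ`, and meromorphic at every cusp, i.e. each `f ∣[k] M` with
`M ∈ SL₂(ℤ)` is a Laurent series in `exp(2πiτ/h)` with finite principal part, for some `h ≥ 1`. -/
structure IsNearlyHolomorphicModularForm (k : ℤ) (Γ : Subgroup SL(2, ℤ)) (f : ℍ → ℂ) :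
    Prop where
  holomorphic : MDifferentiable 𝓘(ℂ) 𝓘(ℂ) f
  slash_eq : ∀ M ∈ Γ, f ∣[k] M = f
  meromorphic_at_cusps : ∀ M : SL(2, ℤ), ∃ (h : ℕ) (m : ℤ) (a : ℕ → ℂ), 0 < h ∧
    ∀ τ : ℍ,
      HasSum (fun n : ℕ => a n * Complex.exp (2 * Real.pi * Complex.I * τ / h) ^ (m + n : ℤ))
        ((f ∣[k] M) τ)

end ModifiedJacobi

end

/-!
The derivative of `ζ = σ'/σ` is `-℘`, so `ζ(z + ω) - ζ(z)` is constant on the connected complement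
of the lattice. Integrating gives `σ(z + ω) = ±exp(η(ω)(z + ω/2)) σ(z)`; the sign is `ψ(ω)` because
`σ` is odd. Hence `ρ⁻¹σ` has period `1` and is a theta function for `[τ, 1]`. Comparing it with
Jacobi's `θ` through Liouville's theorem shows that it has degree `1`, which is Legendre's relation,
and that `ρ⁻¹σ = θ / θ'(0)`. Here `θ'(0)` is a power series in `q` without zeros in the unit disc,
so `θ / θ'(0)` has a Fourier development with `r = O(√n)`.

By Legendre's relation, `𝔨_(a,b)` acquires the factor `ψ(mτ + n) exp(πi(an - bm))` under
`(a, b) ↦ (a + m, b + n)`. For `(a, b) ∈ N⁻¹ℤ²` this factor is `1` for the shifts induced by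
`Γ(2N²)`. As `r = o(n)`, the Fourier development of `ρ⁻¹σ` at a torsion point `aτ + b` has only
finitely many negative powers of `q`.
-/

noncomputable section

namespace ModifiedJacobi

open Complex Filter Topology Set

open scoped Real

section Sigma

variable {Λ Λ' : Submodule ℤ ℂ}

lemma sigmaFactor_zero_right (z : ℂ) : sigmaFactor z 0 = 1 := by simp [sigmaFactor]

lemma sigmaFactor_eq_zero_iff {z l : ℂ} : sigmaFactor z l = 0 ↔ l ≠ 0 ∧ z = l := by
  rcases eq_or_ne l 0 with rfl | hl
  · simp [sigmaFactor]
  · rw [sigmaFactor, mul_eq_zero_iff_right (exp_ne_zero _), sub_eq_zero, eq_comm,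
      div_eq_one_iff_eq hl, and_iff_right hl]

lemma sigmaFactor_mul_mul {c : ℂ} (hc : c ≠ 0) (z l : ℂ) :
    sigmaFactor (c * z) (c * l) = sigmaFactor z l := by
  rw [sigmaFactor, mul_div_mul_left _ _ hc, sigmaFactor]

lemma hasDerivAt_sigmaFactor (l z : ℂ) :
    HasDerivAt (fun z => sigmaFactor z l)
      (-(z / l) ^ 2 * exp (z / l + (z / l) ^ 2 / 2) * l⁻¹) z := by
  have hdiv : HasDerivAt (fun z : ℂ => z / l) l⁻¹ z := by
    simpa using (hasDerivAt_id z).div_const l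
  refine ((hdiv.const_sub 1).mul (hdiv.add ((hdiv.pow 2).div_const 2)).cexp).congr_deriv ?_
  simp only [Pi.add_apply, Pi.pow_apply]
  ring

lemma differentiable_sigmaFactor (l : ℂ) : Differentiable ℂ fun z => sigmaFactor z l :=
  fun z => (hasDerivAt_sigmaFactor l z).differentiableAt

/-- The summand of the lattice sum for the Weierstrass `ζ`-function. Division by zero makes the
summand at `l = 0` equal to `1 / z`, which is exactly the term contributed by the factor `z`
of `σ`. -/
def zetaTerm (z l : ℂ) : ℂ :=
  1 / (z - l) + 1 / l + z / l ^ 2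

lemma logDeriv_sigmaFactor {z l : ℂ} (hl : l ≠ 0) (hz : z ≠ l) :
    logDeriv (fun z => sigmaFactor z l) z = zetaTerm z l := by
  have hzl : z - l ≠ 0 := sub_ne_zero.2 hz
  have hlz : l - z ≠ 0 := sub_ne_zero.2 hz.symm
  rw [logDeriv_apply, (hasDerivAt_sigmaFactor l z).deriv, sigmaFactor, zetaTerm, one_sub_div hl]
  field_simp
  ring

lemma norm_sigmaFactor_sub_one_le {r : ℝ} {z l : ℂ} (hz : ‖z‖ ≤ r) (hl : r ≤ ‖l‖) :
    ‖sigmaFactor z l - 1‖ ≤ Real.exp 2 * r ^ 3 * ‖l‖ ^ (-3 : ℝ) := by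
  have hr : 0 ≤ r := (norm_nonneg z).trans hz
  have hderiv : ∀ x ∈ Metric.closedBall (0 : ℂ) r,
      ‖-(x / l) ^ 2 * exp (x / l + (x / l) ^ 2 / 2) * l⁻¹‖ ≤
        (r / ‖l‖) ^ 2 * Real.exp 2 * ‖l‖⁻¹ := fun x hx => by
    have hx' : ‖x‖ ≤ r := mem_closedBall_zero_iff.1 hx
    have hxl : ‖x / l‖ ≤ 1 := by
      rw [norm_div]; exact div_le_one_of_le₀ (hx'.trans hl) (norm_nonneg l)
    have hexp : (x / l + (x / l) ^ 2 / 2).re ≤ 2 := calc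
      _ ≤ ‖x / l‖ + ‖x / l‖ ^ 2 / 2 :=
        (re_le_norm _).trans ((norm_add_le _ _).trans_eq (by simp))
      _ ≤ 2 := by nlinarith [norm_nonneg (x / l)]
    rw [norm_mul, norm_mul, norm_neg, norm_pow, norm_div, norm_inv, norm_exp]
    gcongr
  have hmvt := (convex_closedBall (0 : ℂ) r).norm_image_sub_le_of_norm_hasDerivWithin_le
    (fun x _ => (hasDerivAt_sigmaFactor l x).hasDerivWithinAt) hderiv
    (Metric.mem_closedBall_self hr) (mem_closedBall_zero_iff.2 hz)
  have hzero : sigmaFactor 0 l = 1 := by simp [sigmaFactor]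
  rw [hzero, sub_zero] at hmvt
  calc ‖sigmaFactor z l - 1‖ ≤ (r / ‖l‖) ^ 2 * Real.exp 2 * ‖l‖⁻¹ * ‖z‖ := hmvt
    _ ≤ (r / ‖l‖) ^ 2 * Real.exp 2 * ‖l‖⁻¹ * r := by gcongr
    _ = Real.exp 2 * r ^ 3 * (‖l‖ ^ 3)⁻¹ := by ring
    _ = _ := by rw [Real.rpow_neg (norm_nonneg l)]; norm_cast

lemma norm_zetaTerm_le {r : ℝ} {z l : ℂ} (hr : 0 < r) (hz : ‖z‖ ≤ r) (hl : 2 * r ≤ ‖l‖) :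
    ‖zetaTerm z l‖ ≤ 2 * r ^ 2 * ‖l‖ ^ (-3 : ℝ) := by
  have hl0 : 0 < ‖l‖ := by linarith
  have hl_ne : l ≠ 0 := norm_pos_iff.1 hl0
  have hsub : ‖l‖ / 2 ≤ ‖z - l‖ := by
    linarith [norm_sub_norm_le l z, norm_sub_rev l z]
  have hsub_ne : z - l ≠ 0 := norm_pos_iff.1 (by linarith)
  have hterm : zetaTerm z l = z ^ 2 / (l ^ 2 * (z - l)) := by
    rw [zetaTerm]
    field_simp
    ring
  calc ‖zetaTerm z l‖ = ‖z‖ ^ 2 / (‖l‖ ^ 2 * ‖z - l‖) := by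
        rw [hterm, norm_div, norm_mul, norm_pow, norm_pow]
    _ ≤ r ^ 2 / (‖l‖ ^ 2 * (‖l‖ / 2)) := by gcongr
    _ = 2 * r ^ 2 * (‖l‖ ^ 3)⁻¹ := by field_simp
    _ = _ := by rw [Real.rpow_neg hl0.le]; norm_cast

lemma weierstrassSigma_eq_mul_tprod (Λ : Submodule ℤ ℂ) (z : ℂ) :
    weierstrassSigma Λ z = z * ∏' l : Λ, sigmaFactor z l := by
  have hind : ((Λ : Set ℂ) \ {0}).mulIndicator (sigmaFactor z) =
      (Λ : Set ℂ).mulIndicator (sigmaFactor z) := by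
    ext l
    by_cases hl : l ∈ Λ ∧ l ≠ 0
    · rw [mulIndicator_of_mem (show l ∈ (Λ : Set ℂ) \ {0} from hl), mulIndicator_of_mem hl.1]
    · by_cases l = 0 <;> simp_all [sigmaFactor_zero_right]
  rw [weierstrassSigma, tprod_subtype, hind, ← tprod_subtype]
  rfl

lemma weierstrassSigma_mul {c : ℂ} (hc : c ≠ 0) (hΛ : ∀ w, w ∈ Λ ↔ c * w ∈ Λ') (z : ℂ) :
    weierstrassSigma Λ' (c * z) = c * weierstrassSigma Λ z := by
  let e : Λ ≃ Λ' := (Equiv.mulLeft₀ c hc).subtypeEquiv hΛ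
  rw [weierstrassSigma_eq_mul_tprod, weierstrassSigma_eq_mul_tprod, ← e.tprod_eq, mul_assoc]
  congr 2
  exact tprod_congr fun w => sigmaFactor_mul_mul hc z w

lemma weierstrassZeta_mul {c : ℂ} (hc : c ≠ 0) (hΛ : ∀ w, w ∈ Λ ↔ c * w ∈ Λ') (z : ℂ) :
    weierstrassZeta Λ z = c * weierstrassZeta Λ' (c * z) := by
  have hderiv : c * deriv (weierstrassSigma Λ') (c * z) = c * deriv (weierstrassSigma Λ) z := by
    rw [← smul_eq_mul c, ← deriv_comp_mul_left, funext (weierstrassSigma_mul hc hΛ),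
      deriv_const_mul_field']
  rw [weierstrassZeta, weierstrassZeta, weierstrassSigma_mul hc hΛ, mul_left_cancel₀ hc hderiv,
    ← mul_div_assoc, mul_div_mul_left _ _ hc]

lemma weierstrassSigma_neg (Λ : Submodule ℤ ℂ) (z : ℂ) :
    weierstrassSigma Λ (-z) = -weierstrassSigma Λ z := by
  simpa using weierstrassSigma_mul (Λ := Λ) (Λ' := Λ) (neg_ne_zero.2 one_ne_zero) (by simp) z

lemma weierstrassZeta_neg (Λ : Submodule ℤ ℂ) (z : ℂ) :
    weierstrassZeta Λ (-z) = -weierstrassZeta Λ z := by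
  simpa using
    (weierstrassZeta_mul (Λ := Λ) (Λ' := Λ) (neg_ne_zero.2 one_ne_zero) (by simp) (-z))

section Discrete

variable (Λ) [DiscreteTopology Λ]

lemma summable_norm_rpow_neg_three : Summable fun l : Λ => ‖(l : ℂ)‖ ^ (-3 : ℝ) := by
  have hrank : Module.finrank ℤ Λ ≤ 2 := by
    have hspan : Submodule.span ℤ (Λ : Set ℂ) = Λ := Submodule.span_eq Λ
    have hdisc : DiscreteTopology (Submodule.span ℤ (Λ : Set ℂ)) := by rwa [hspan]
    have := Real.finrank_eq_int_finrank_of_discrete hdisc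
    rw [Set.finrank, Set.finrank, hspan] at this
    exact this ▸ (Submodule.finrank_le _).trans_eq finrank_real_complex
  refine ZLattice.summable_norm_rpow Λ _ (neg_lt_neg ?_)
  exact_mod_cast (hrank.trans_lt (by norm_num) : Module.finrank ℤ Λ < 3)

lemma isClosed_of_discreteTopology : IsClosed (Λ : Set ℂ) :=
  have : DiscreteTopology Λ.toAddSubgroup := inferInstanceAs (DiscreteTopology Λ)
  AddSubgroup.isClosed_of_discrete (H := Λ.toAddSubgroup)

lemma eventually_cofinite_le_norm (r : ℝ) : ∀ᶠ l : Λ in cofinite, r ≤ ‖(l : ℂ)‖ := by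
  have hfin := ((Metric.finite_isBounded_inter_isClosed DiscreteTopology.isDiscrete
    Metric.isBounded_ball (isClosed_of_discreteTopology Λ)).preimage_embedding
      (.subtype _) : Set.Finite ((↑) ⁻¹' (Metric.ball (0 : ℂ) r ∩ (Λ : Set ℂ)) : Set Λ))
  filter_upwards [hfin.compl_mem_cofinite] with l hl
  simpa using hl

lemma eventually_norm_sigmaFactor_sub_one_le (r : ℝ) :
    ∀ᶠ l : Λ in cofinite, ∀ z ∈ Metric.ball (0 : ℂ) r,
      ‖sigmaFactor z l - 1‖ ≤ Real.exp 2 * r ^ 3 * ‖(l : ℂ)‖ ^ (-3 : ℝ) := by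
  filter_upwards [eventually_cofinite_le_norm Λ r] with l hl z hz
  exact norm_sigmaFactor_sub_one_le (mem_ball_zero_iff.1 hz).le hl

lemma summable_norm_sigmaFactor_sub_one (z : ℂ) :
    Summable fun l : Λ => ‖sigmaFactor z l - 1‖ := by
  refine Summable.of_norm_bounded_eventually
    ((summable_norm_rpow_neg_three Λ).mul_left (Real.exp 2 * (‖z‖ + 1) ^ 3)) ?_
  filter_upwards [eventually_norm_sigmaFactor_sub_one_le Λ (‖z‖ + 1)] with l hl
  simpa using hl z (by simp)

lemma multipliable_sigmaFactor (z : ℂ) :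
    Multipliable fun ω : ↥((Λ : Set ℂ) \ {0}) => sigmaFactor z ω := by
  have hinj := Set.inclusion_injective (s := (Λ : Set ℂ) \ {0}) (t := Λ) sdiff_subset
  have hsum := (summable_norm_sigmaFactor_sub_one Λ z).comp_injective hinj
  simpa using multipliable_one_add_of_summable hsum

lemma multipliableLocallyUniformlyOn_sigmaFactor (r : ℝ) :
    MultipliableLocallyUniformlyOn (fun (l : Λ) z => sigmaFactor z l)
      (Metric.ball (0 : ℂ) r) := by
  simpa using Summable.multipliableLocallyUniformlyOn_one_add Metric.isOpen_ball
    ((summable_norm_rpow_neg_three Λ).mul_left (Real.exp 2 * r ^ 3))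
    (eventually_norm_sigmaFactor_sub_one_le Λ r)
    (fun l => ((differentiable_sigmaFactor l).continuous.sub continuous_const).continuousOn)

lemma differentiable_tprod_sigmaFactor :
    Differentiable ℂ fun z => ∏' l : Λ, sigmaFactor z l := fun z => by
  have hprod := (multipliableLocallyUniformlyOn_sigmaFactor Λ (‖z‖ + 1)).hasProdLocallyUniformlyOn
  have hdiff := hprod.differentiableOn (.of_forall fun s =>
    .fun_finsetProd fun l _ => (differentiable_sigmaFactor l).differentiableOn) Metric.isOpen_ball
  exact hdiff.differentiableAt (Metric.isOpen_ball.mem_nhds (by simp))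

lemma differentiable_weierstrassSigma : Differentiable ℂ (weierstrassSigma Λ) := by
  rw [funext (weierstrassSigma_eq_mul_tprod Λ)]
  exact differentiable_id.mul (differentiable_tprod_sigmaFactor Λ)

lemma deriv_weierstrassSigma_zero : deriv (weierstrassSigma Λ) 0 = 1 := by
  rw [funext (weierstrassSigma_eq_mul_tprod Λ),
    deriv_fun_mul differentiableAt_fun_id (differentiable_tprod_sigmaFactor Λ 0)]
  simp [sigmaFactor]

variable {Λ}

lemma tprod_sigmaFactor_ne_zero {z : ℂ} (hz : z ∉ Λ) : ∏' l : Λ, sigmaFactor z l ≠ 0 := by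
  have hfactor (l : Λ) : 1 + (sigmaFactor z l - 1) ≠ 0 := fun h =>
    hz ((sigmaFactor_eq_zero_iff.1 ((add_sub_cancel _ _).symm.trans h)).2 ▸ l.2)
  simpa using
    tprod_one_add_ne_zero_of_summable hfactor (summable_norm_sigmaFactor_sub_one Λ z)

lemma weierstrassSigma_eq_zero_iff {z : ℂ} : weierstrassSigma Λ z = 0 ↔ z ∈ Λ := by
  rw [weierstrassSigma_eq_mul_tprod]
  refine ⟨fun h => ?_, fun hz => ?_⟩
  · by_contra hz
    exact mul_ne_zero (ne_of_mem_of_not_mem Λ.zero_mem hz).symm (tprod_sigmaFactor_ne_zero hz) h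
  · rcases eq_or_ne z 0 with rfl | hz0
    · exact zero_mul _
    · rw [tprod_of_exists_eq_zero ⟨(⟨z, hz⟩ : Λ), sigmaFactor_eq_zero_iff.2 ⟨hz0, rfl⟩⟩, mul_zero]

lemma summable_zetaTerm (z : ℂ) : Summable fun l : Λ => zetaTerm z l := by
  refine Summable.of_norm_bounded_eventually
    ((summable_norm_rpow_neg_three Λ).mul_left (2 * (‖z‖ + 1) ^ 2)) ?_
  filter_upwards [eventually_cofinite_le_norm Λ (2 * (‖z‖ + 1))] with l hl
  exact norm_zetaTerm_le (by positivity) (by linarith) hl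

lemma hasSum_logDeriv_sigmaFactor {z : ℂ} (hz : z ∉ Λ) :
    HasSum (fun l : Λ => logDeriv (fun z => sigmaFactor z l) z)
      (∑' l : Λ, zetaTerm z l - 1 / z) := by
  classical
  convert! (summable_zetaTerm z).hasSum.update (0 : Λ) 0 using 1
  · ext l
    rcases eq_or_ne l 0 with rfl | hl
    · simp [logDeriv_apply, sigmaFactor_zero_right]
    · rw [Function.update_of_ne hl, logDeriv_sigmaFactor (by simpa using hl)
        (ne_of_mem_of_not_mem l.2 hz).symm]
  · simp only [zetaTerm, ZeroMemClass.coe_zero, sub_zero, div_zero, ne_eq, OfNat.ofNat_ne_zero,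
      not_false_eq_true, zero_pow]
    ring

theorem weierstrassZeta_eq_tsum {z : ℂ} (hz : z ∉ Λ) :
    weierstrassZeta Λ z = ∑' l : Λ, zetaTerm z l := by
  have hprod : ∏' l : Λ, sigmaFactor z l ≠ 0 := tprod_sigmaFactor_ne_zero hz
  have hlog := logDeriv_tprod_eq_tsum (Metric.isOpen_ball (x := (0 : ℂ)) (ε := ‖z‖ + 1))
    (x := z) (by simp) (f := fun (l : Λ) z => sigmaFactor z l)
    (fun l h => hz ((sigmaFactor_eq_zero_iff.1 h).2 ▸ l.2))
    (fun l => (differentiable_sigmaFactor l).differentiableOn)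
    (hasSum_logDeriv_sigmaFactor hz).summable (multipliableLocallyUniformlyOn_sigmaFactor Λ _) hprod
  calc weierstrassZeta Λ z = logDeriv (fun z => z * ∏' l : Λ, sigmaFactor z l) z := by
        rw [← funext (weierstrassSigma_eq_mul_tprod Λ)]; rfl
    _ = 1 / z + (∑' l : Λ, zetaTerm z l - 1 / z) := by
        rw [logDeriv_mul z (ne_of_mem_of_not_mem Λ.zero_mem hz).symm hprod differentiableAt_fun_id
          (differentiable_tprod_sigmaFactor Λ z), hlog, (hasSum_logDeriv_sigmaFactor hz).tsum_eq]
        simp [logDeriv_apply]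
    _ = _ := add_sub_cancel _ _

end Discrete

end Sigma

section Lattice

variable (Λ : Submodule ℤ ℂ) [DiscreteTopology Λ]

lemma countable_of_discreteTopology : (Λ : Set ℂ).Countable :=
  countable_coe_iff.1 (countable_of_Lindelof_of_discrete (X := Λ))

lemma isPreconnected_compl : IsPreconnected (Λ : Set ℂ)ᶜ :=
  ((countable_of_discreteTopology Λ).isConnected_compl_of_one_lt_rank (by simp)).isPreconnected

end Lattice

section QuasiPeriod

variable {L : PeriodPair}

lemma hasDerivAt_zetaTerm {z l : ℂ} (hz : z ≠ l) :
    HasDerivAt (fun z => zetaTerm z l) (-(1 / (z - l) ^ 2 - 1 / l ^ 2)) z := by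
  have hinv := ((hasDerivAt_id z).sub_const l).inv (sub_ne_zero.2 hz)
  have hsum := (hinv.add_const (1 / l)).add ((hasDerivAt_id z).div_const (l ^ 2))
  refine (hsum.congr_deriv ?_).congr_of_eventuallyEq (.of_forall fun w => ?_)
  · simp only [id]; ring
  · simp [zetaTerm, one_div]

lemma hasSumLocallyUniformly_zetaTerm (L : PeriodPair) :
    HasSumLocallyUniformly (fun (l : L.lattice) (z : ℂ) => zetaTerm z l)
      fun z => ∑' l : L.lattice, zetaTerm z l := by
  refine L.hasSumLocallyUniformly_aux (u := fun r l => 2 * r ^ 2 * ‖(l : ℂ)‖ ^ (-3 : ℝ)) _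
    (fun _ _ => (summable_norm_rpow_neg_three L.lattice).mul_left _) fun r hr =>
    eventually_atTop.mpr ⟨2 * r, ?_⟩
  rintro _ hl z hz l rfl
  exact norm_zetaTerm_le hr hz.le hl

theorem hasDerivAt_weierstrassZeta {z : ℂ} (hz : z ∉ L.lattice) :
    HasDerivAt (weierstrassZeta L.lattice) (-L.weierstrassP z) z := by
  have hopen : IsOpen (L.lattice : Set ℂ)ᶜ := L.isClosed_lattice.isOpen_compl
  have hterm (l : L.lattice) {w : ℂ} (hw : w ∉ L.lattice) :=
    hasDerivAt_zetaTerm (ne_of_mem_of_not_mem l.2 hw).symm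
  have hunif := hasSumLocallyUniformlyOn_iff_tendstoLocallyUniformlyOn.1
    ((hasSumLocallyUniformly_zetaTerm L).hasSumLocallyUniformlyOn (s := (L.lattice : Set ℂ)ᶜ))
  have hdiff : ∀ᶠ s : Finset L.lattice in atTop, DifferentiableOn ℂ
      (fun z => ∑ l ∈ s, zetaTerm z l) (L.lattice : Set ℂ)ᶜ :=
    .of_forall fun s => .fun_sum fun l _ w hw =>
      (hterm l hw).differentiableAt.differentiableWithinAt
  have hderiv : deriv (fun z => ∑' l : L.lattice, zetaTerm z l) z = -L.weierstrassP z := by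
    refine tendsto_nhds_unique ((hunif.deriv hdiff hopen).tendsto_at hz)
      ((L.hasSum_weierstrassP z).neg.congr fun s => ?_)
    exact (HasDerivAt.fun_sum fun l _ => hterm l hz).deriv.symm
  have hsum : HasDerivAt (fun z => ∑' l : L.lattice, zetaTerm z l) (-L.weierstrassP z) z :=
    hderiv ▸ ((hunif.differentiableOn hdiff hopen).differentiableAt
      (hopen.mem_nhds hz)).hasDerivAt
  refine hsum.congr_of_eventuallyEq ?_
  filter_upwards [hopen.mem_nhds hz] with w hw using weierstrassZeta_eq_tsum hw

lemma exists_weierstrassZeta_add {ω : ℂ} (hω : ω ∈ L.lattice) :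
    ∃ c : ℂ, ∀ z : ℂ, z ∉ L.lattice →
      weierstrassZeta L.lattice (z + ω) = weierstrassZeta L.lattice z + c := by
  have hderiv : ∀ z ∈ (L.lattice : Set ℂ)ᶜ, HasDerivAt
      (fun z => weierstrassZeta L.lattice (z + ω) - weierstrassZeta L.lattice z) 0 z := by
    intro z hz
    have hzω : z + ω ∉ L.lattice := mt (L.lattice.add_mem_iff_left hω).1 hz
    refine (((hasDerivAt_weierstrassZeta hzω).comp_add_const z ω).sub
      (hasDerivAt_weierstrassZeta hz)).congr_deriv ?_
    rw [L.weierstrassP_add_coe z ⟨ω, hω⟩, sub_self]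
  obtain ⟨c, hc⟩ := L.isClosed_lattice.isOpen_compl.exists_is_const_of_deriv_eq_zero
    (isPreconnected_compl L.lattice)
    (fun z hz => (hderiv z hz).differentiableAt.differentiableWithinAt)
    (fun z hz => (hderiv z hz).deriv)
  exact ⟨c, fun z hz => eq_add_of_sub_eq' (hc z hz)⟩

lemma weierstrassEta_add (L : PeriodPair) (z w : ℂ) :
    weierstrassEta L (z + w) = weierstrassEta L z + weierstrassEta L w := by
  simp only [weierstrassEta, map_add, Finsupp.add_apply, ofReal_add]
  ring

lemma weierstrassEta_ofReal_mul (L : PeriodPair) (a : ℝ) (z : ℂ) :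
    weierstrassEta L (a * z) = a * weierstrassEta L z := by
  simp only [← real_smul, weierstrassEta, map_smul, Finsupp.smul_apply, smul_eq_mul, ofReal_mul]
  simp only [real_smul]
  ring

lemma weierstrassEta_neg (L : PeriodPair) (z : ℂ) :
    weierstrassEta L (-z) = -weierstrassEta L z := by
  simpa using weierstrassEta_ofReal_mul L (-1) z

lemma weierstrassEta_ω₁ (L : PeriodPair) :
    weierstrassEta L L.ω₁ = quasiPeriod L.lattice L.ω₁ := by
  simp [weierstrassEta, ← L.basis_zero, -PeriodPair.basis_zero]

lemma weierstrassEta_ω₂ (L : PeriodPair) :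
    weierstrassEta L L.ω₂ = quasiPeriod L.lattice L.ω₂ := by
  simp [weierstrassEta, ← L.basis_one, -PeriodPair.basis_one]

theorem weierstrassZeta_add {z ω : ℂ} (hω : ω ∈ L.lattice) (hz : z ∉ L.lattice) :
    weierstrassZeta L.lattice (z + ω) = weierstrassZeta L.lattice z + weierstrassEta L ω := by
  have hspan (w : ℂ) : w ∈ L.lattice ↔ w ∈ AddSubgroup.closure {L.ω₁, L.ω₂} := by
    rw [← Submodule.span_int_eq_addSubgroupClosure]
    rfl
  rw [hspan] at hω
  induction hω using AddSubgroup.closure_induction generalizing z with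
  | mem ω h =>
    have hη : weierstrassEta L ω = quasiPeriod L.lattice ω := by
      rcases h with rfl | rfl
      exacts [weierstrassEta_ω₁ L, weierstrassEta_ω₂ L]
    rw [hη]
    exact Classical.epsilon_spec (exists_weierstrassZeta_add (Submodule.subset_span h)) z hz
  | zero => simp [weierstrassEta]
  | add ω ω' h _ ih ih' =>
    rw [← add_assoc, ih' (mt (L.lattice.add_mem_iff_left ((hspan ω).2 h)).1 hz), ih hz,
      weierstrassEta_add, add_assoc]
  | neg ω h ih =>
    have := ih (mt (L.lattice.add_mem_iff_left (neg_mem ((hspan ω).2 h))).1 hz)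
    rw [neg_add_cancel_right] at this
    rw [this, weierstrassEta_neg, add_neg_cancel_right]

lemma weierstrassEta_eq_of_forall {ω c : ℂ} (hω : ω ∈ L.lattice)
    (h : ∀ z ∉ L.lattice, weierstrassZeta L.lattice (z + ω) = weierstrassZeta L.lattice z + c) :
    weierstrassEta L ω = c :=
  add_left_cancel ((weierstrassZeta_add hω L.ω₂_div_two_notMem_lattice).symm.trans
    (h _ L.ω₂_div_two_notMem_lattice))

lemma exists_ofReal_combination (L : PeriodPair) (z : ℂ) :
    ∃ a b : ℝ, z = a * L.ω₁ + b * L.ω₂ := by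
  refine ⟨L.basis.repr z 0, L.basis.repr z 1, ?_⟩
  simpa [Fin.sum_univ_two] using (L.basis.sum_repr z).symm

lemma weierstrassEta_mul {L L' : PeriodPair} {c : ℂ} (hc : c ≠ 0)
    (hL : ∀ w, w ∈ L.lattice ↔ c * w ∈ L'.lattice) (z : ℂ) :
    weierstrassEta L z = c * weierstrassEta L' (c * z) := by
  have hlattice {w : ℂ} (hw : w ∈ L.lattice) :
      weierstrassEta L w = c * weierstrassEta L' (c * w) := by
    refine weierstrassEta_eq_of_forall hw fun z hz => ?_
    rw [weierstrassZeta_mul hc hL, weierstrassZeta_mul hc hL, mul_add,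
      weierstrassZeta_add ((hL w).1 hw) (mt (hL z).2 hz), mul_add]
  obtain ⟨a, b, rfl⟩ := exists_ofReal_combination L z
  rw [mul_add, mul_left_comm c, mul_left_comm c]
  simp only [weierstrassEta_add, weierstrassEta_ofReal_mul, hlattice L.ω₁_mem_lattice,
    hlattice L.ω₂_mem_lattice]
  ring

lemma psi_mul {Λ Λ' : Submodule ℤ ℂ} {c : ℂ} (hc : c ≠ 0) (hΛ : ∀ w, w ∈ Λ ↔ c * w ∈ Λ') (z : ℂ) :
    psi Λ z = psi Λ' (c * z) := by
  have hdouble : (∃ w ∈ Λ, z = 2 * w) ↔ ∃ w ∈ Λ', c * z = 2 * w := by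
    refine ⟨fun ⟨w, hw, hz⟩ => ⟨c * w, (hΛ w).1 hw, by rw [hz, mul_left_comm]⟩,
      fun ⟨w, hw, hz⟩ => ⟨c⁻¹ * w, (hΛ _).2 (by rwa [mul_inv_cancel_left₀ hc]), ?_⟩⟩
    rw [mul_left_comm, ← hz, inv_mul_cancel_left₀ hc]
  unfold psi
  congr 1
  rw [hΛ z, hdouble]

lemma psi_two_mul {Λ : Submodule ℤ ℂ} {w : ℂ} (hw : w ∈ Λ) : psi Λ (2 * w) = 1 :=
  if_neg fun h => h.2 ⟨w, hw, rfl⟩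

lemma psi_inv (Λ : Submodule ℤ ℂ) (z : ℂ) : (psi Λ z)⁻¹ = psi Λ z := by
  unfold psi
  split_ifs <;> norm_num

lemma psi_ne_zero (Λ : Submodule ℤ ℂ) (z : ℂ) : psi Λ z ≠ 0 := by
  unfold psi
  split_ifs <;> norm_num

lemma logDeriv_exp_mul (c z : ℂ) : logDeriv (fun z => exp (c * z)) z = c := by
  have hderiv : HasDerivAt (fun z => exp (c * z)) (exp (c * z) * c) z := by
    simpa using ((hasDerivAt_id z).const_mul c).cexp
  rw [logDeriv_apply, hderiv.deriv, mul_div_cancel_left₀ _ (exp_ne_zero _)]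

/-- The exponent is centred at the midpoint of `z` and `z + ω`, so that oddness of `σ` makes
`C = ±1`. -/
lemma exists_weierstrassSigma_add {ω : ℂ} (hω : ω ∈ L.lattice) :
    ∃ C : ℂ, ∀ z, weierstrassSigma L.lattice (z + ω) =
      C * exp (weierstrassEta L ω * (z + 1 / 2 * ω)) * weierstrassSigma L.lattice z := by
  set σ := weierstrassSigma L.lattice
  set c := weierstrassEta L ω
  have hσ : Differentiable ℂ σ := differentiable_weierstrassSigma L.lattice
  have hσ_zero {z : ℂ} : σ z = 0 ↔ z ∈ L.lattice := weierstrassSigma_eq_zero_iff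
  have hadd {z : ℂ} (hz : z ∉ L.lattice) : z + ω ∉ L.lattice :=
    mt (L.lattice.add_mem_iff_left hω).1 hz
  have hlog : EqOn (logDeriv fun z => σ (z + ω)) (logDeriv fun z => exp (c * z) * σ z)
      (L.lattice : Set ℂ)ᶜ := fun z hz => by
    rw [logDeriv_mul (f := fun z => exp (c * z)) z (exp_ne_zero _) (mt hσ_zero.1 hz)
      (by fun_prop) (hσ z), logDeriv_exp_mul, logDeriv_apply, deriv_comp_add_const, add_comm c]
    exact weierstrassZeta_add hω hz
  obtain ⟨C, -, hC⟩ := (logDeriv_eqOn_iff (by fun_prop) (by fun_prop)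
    L.isClosed_lattice.isOpen_compl (isPreconnected_compl L.lattice)
    (fun z hz => mul_ne_zero (exp_ne_zero _) (mt hσ_zero.1 hz))
    fun z hz => mt hσ_zero.1 (hadd hz)).1 hlog
  refine ⟨C * exp (-(c * (1 / 2 * ω))), fun z => ?_⟩
  by_cases hz : z ∈ L.lattice
  · rw [hσ_zero.2 hz, hσ_zero.2 (add_mem hz hω), mul_zero]
  · rw [mul_assoc C, ← exp_add, mul_add, neg_add_cancel_comm_assoc, mul_assoc]
    exact hC hz

lemma sq_eq_one_of_weierstrassSigma_add {C c ω : ℂ}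
    (hC : ∀ z, weierstrassSigma L.lattice (z + ω) =
      C * exp (c * (z + 1 / 2 * ω)) * weierstrassSigma L.lattice z) : C ^ 2 = 1 := by
  set z := L.ω₂ / 2
  have hz : weierstrassSigma L.lattice z ≠ 0 :=
    mt weierstrassSigma_eq_zero_iff.1 L.ω₂_div_two_notMem_lattice
  have hreflect := hC (-(z + ω))
  rw [show -(z + ω) + ω = -z by ring, weierstrassSigma_neg, weierstrassSigma_neg, hC z,
    show c * (-(z + ω) + 1 / 2 * ω) = -(c * (z + 1 / 2 * ω)) by ring, exp_neg] at hreflect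
  field_simp at hreflect
  linear_combination hreflect

theorem weierstrassSigma_add {ω : ℂ} (hω : ω ∈ L.lattice) (z : ℂ) :
    weierstrassSigma L.lattice (z + ω) = psi L.lattice ω *
      exp (weierstrassEta L ω * (z + 1 / 2 * ω)) * weierstrassSigma L.lattice z := by
  by_cases hdouble : ∃ w ∈ L.lattice, ω = 2 * w
  · obtain ⟨w, hw, rfl⟩ := hdouble
    obtain ⟨C, hC⟩ := exists_weierstrassSigma_add hw
    rw [psi_two_mul hw, two_mul w, ← add_assoc, hC, hC, weierstrassEta_add]
    calc _ = C ^ 2 * (exp (weierstrassEta L w * (z + w + 1 / 2 * w)) *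
          exp (weierstrassEta L w * (z + 1 / 2 * w))) * weierstrassSigma L.lattice z := by ring
      _ = _ := by
        rw [sq_eq_one_of_weierstrassSigma_add hC, ← exp_add]
        congr 3
        ring
  · obtain ⟨C, hC⟩ := exists_weierstrassSigma_add hω
    suffices C = -1 by rw [hC, this, psi, if_pos ⟨hω, hdouble⟩]
    have hhalf : weierstrassSigma L.lattice (1 / 2 * ω) ≠ 0 := fun h =>
      hdouble ⟨1 / 2 * ω, weierstrassSigma_eq_zero_iff.1 h, by ring⟩
    have hmid := hC (-(1 / 2 * ω))
    rw [neg_add_cancel, mul_zero, exp_zero, weierstrassSigma_neg,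
      show -(1 / 2 * ω) + ω = 1 / 2 * ω by ring] at hmid
    exact mul_right_cancel₀ hhalf (by linear_combination hmid)

lemma deriv_weierstrassSigma_ne_zero {ω : ℂ} (hω : ω ∈ L.lattice) :
    deriv (weierstrassSigma L.lattice) ω ≠ 0 := by
  have hE : DifferentiableAt ℂ
      (fun z => psi L.lattice ω * exp (weierstrassEta L ω * (z + 1 / 2 * ω))) 0 := by fun_prop
  have hderiv := deriv_comp_add_const (weierstrassSigma L.lattice) ω 0
  rw [funext (weierstrassSigma_add hω),
    deriv_fun_mul hE (differentiable_weierstrassSigma L.lattice 0),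
    weierstrassSigma_eq_zero_iff.2 L.lattice.zero_mem, deriv_weierstrassSigma_zero, zero_add,
    mul_zero, zero_add, mul_one, zero_add ω] at hderiv
  rw [← hderiv]
  exact mul_ne_zero (psi_ne_zero _ _) (exp_ne_zero _)

end QuasiPeriod

section Quotient

lemma exists_differentiable_quotient {f g : ℂ → ℂ} (hf : Differentiable ℂ f)
    (hg : Differentiable ℂ g) (h : ∀ z, g z = 0 → f z = 0 ∧ deriv g z ≠ 0) :
    ∃ H : ℂ → ℂ, Differentiable ℂ H ∧ ∀ z, f z = g z * H z := by
  classical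
  have hslope {F : ℂ → ℂ} (hF : Differentiable ℂ F) (w : ℂ) : Differentiable ℂ (dslope F w) :=
    differentiableOn_univ.1 ((differentiableOn_dslope univ_mem).2 hF.differentiableOn)
  have hfactor {F : ℂ → ℂ} {w : ℂ} (hF : F w = 0) (z : ℂ) : F z = (z - w) * dslope F w z := by
    simpa [hF] using (sub_smul_dslope F w z).symm
  refine ⟨fun z => if g z = 0 then deriv f z / deriv g z else f z / g z, fun w => ?_, fun z => ?_⟩
  · by_cases hw : g w = 0
    · obtain ⟨hfw, hgw⟩ := h w hw
      have hne : dslope g w w ≠ 0 := by rwa [dslope_same]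
      refine ((hslope hf w w).div (hslope hg w w) hne).congr_of_eventuallyEq ?_
      filter_upwards [(hslope hg w).continuous.continuousAt.eventually_ne hne] with z hz
      rcases eq_or_ne z w with rfl | hzw
      · simp [hw]
      · have hzw' : z - w ≠ 0 := sub_ne_zero.2 hzw
        rw [hfactor hw z, hfactor hfw z, if_neg (mul_ne_zero hzw' hz), Pi.div_apply,
          mul_div_mul_left _ _ hzw']
    · refine ((hf w).div (hg w) hw).congr_of_eventuallyEq ?_
      filter_upwards [(hg w).continuousAt.eventually_ne hw] with z hz
      exact if_neg hz
  · dsimp only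
    split_ifs with hz
    · rw [hz, zero_mul, (h z hz).1]
    · rw [mul_div_cancel₀ _ hz]

lemma eq_zero_or_eq_zero_of_differentiable {f g : ℂ → ℂ} (hf : Differentiable ℂ f)
    (hg : Differentiable ℂ g) (h : ∀ z, f z * g z = 0) : f = 0 ∨ g = 0 := by
  simpa [EqOn, funext_iff] using
    AnalyticOnNhd.eq_zero_or_eq_zero_of_mul_eq_zero (fun z _ => hf.analyticAt z)
      (fun z _ => hg.analyticAt z) (fun z _ => h z) isPreconnected_univ

end Quotient

section Liouville

variable {L : PeriodPair}

lemma periodic_of_mem_lattice {α : Type*} {f : ℂ → α} (h₁ : Function.Periodic f L.ω₁)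
    (h₂ : Function.Periodic f L.ω₂) {ω : ℂ} (hω : ω ∈ L.lattice) : Function.Periodic f ω := by
  obtain ⟨m, n, rfl⟩ := PeriodPair.mem_lattice.1 hω
  exact (h₁.int_mul m).add_period (h₂.int_mul n)

lemma eq_apply_zero_of_periodic_norm {f : ℂ → ℂ} (hf : Differentiable ℂ f)
    (h₁ : Function.Periodic (fun z => ‖f z‖) L.ω₁)
    (h₂ : Function.Periodic (fun z => ‖f z‖) L.ω₂) (z : ℂ) : f z = f 0 := by
  obtain ⟨R, hR⟩ := (IsZLattice.isCompact_range_of_periodic L.lattice _ hf.continuous.norm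
    fun z ω hω => periodic_of_mem_lattice h₁ h₂ hω z).isBounded.exists_norm_le
  refine hf.apply_eq_apply_of_bounded (isBounded_iff_forall_norm_le.2 ⟨R, ?_⟩) z 0
  rintro _ ⟨z, rfl⟩
  simpa using hR _ ⟨z, rfl⟩

end Liouville

section Theta

/-- Jacobi's odd theta function, normalized to the series `∑ r, (-1)ʳ q^(r(r-1)/2) ζʳ` so that it
has period `1` in `z`. -/
def theta (τ z : ℂ) : ℂ := jacobiTheta₂ (z + 1 / 2 - τ / 2) τ

lemma theta_add_one (τ z : ℂ) : theta τ (z + 1) = theta τ z := by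
  rw [theta, theta, ← jacobiTheta₂_add_left (z + 1 / 2 - τ / 2)]
  ring_nf

lemma theta_add_self (τ z : ℂ) : theta τ (z + τ) = -exp (-(2 * π * I * z)) * theta τ z := by
  rw [theta, theta, show z + τ + 1 / 2 - τ / 2 = (z + 1 / 2 - τ / 2) + τ by ring,
    jacobiTheta₂_add_left', show -π * I * (τ + 2 * (z + 1 / 2 - τ / 2)) =
      -(2 * π * I * z) + -(π * I) by ring, exp_add, exp_neg (π * I), exp_pi_mul_I, inv_neg_one,
    mul_neg_one]

lemma theta_zero (τ : ℂ) : theta τ 0 = 0 := by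
  have hreflect : theta τ 0 = theta τ (-1 + τ) := by
    rw [theta, ← jacobiTheta₂_neg_left, theta]
    ring_nf
  have hshift : theta τ (-1 + τ) = -theta τ 0 := by
    rw [← theta_add_one, neg_add_cancel_comm]
    simpa using theta_add_self τ 0
  exact self_eq_neg.1 (hreflect.trans hshift)

lemma integral_tsum_mul_exp {a : ℤ → ℂ} (ha : Summable fun n => ‖a n‖) :
    ∫ x in (0 : ℝ)..1, ∑' n, a n * exp (2 * π * I * n * x) = a 0 := by
  let term (n : ℤ) : C(ℝ, ℂ) := ⟨fun x => a n * exp (2 * π * I * n * x), by fun_prop⟩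
  have hnorm (n : ℤ) (x : ℝ) : ‖term n x‖ = ‖a n‖ := by
    simp [term, norm_exp]
  have hsum : Summable fun n => ‖(term n).restrict
      (⟨uIcc (0 : ℝ) 1, isCompact_uIcc⟩ : TopologicalSpace.Compacts ℝ)‖ :=
    ha.of_nonneg_of_le (fun _ => norm_nonneg _) fun n =>
      (ContinuousMap.norm_le _ (norm_nonneg _)).2 fun x => (hnorm n x).le
  have hterm (n : ℤ) (hn : n ≠ 0) : ∫ x in (0 : ℝ)..1, term n x = 0 := by
    have hfreq : 2 * π * I * n ≠ 0 := mul_ne_zero two_pi_I_ne_zero (Int.cast_ne_zero.2 hn)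
    have hperiod : exp (2 * π * I * n) = 1 := exp_eq_one_iff.2 ⟨n, by ring⟩
    simp only [term, ContinuousMap.coe_mk, intervalIntegral.integral_const_mul,
      integral_exp_mul_complex hfreq]
    simp [hperiod]
  refine ((intervalIntegral.hasSum_intervalIntegral_of_summable_norm hsum).unique
    (hasSum_single 0 hterm)).trans ?_
  simp [term]

variable (τ : ℍ)

lemma differentiable_theta : Differentiable ℂ (theta τ) := fun z =>
  (differentiableAt_jacobiTheta₂_fst (z + 1 / 2 - τ / 2) τ.im_pos).comp z
    (f := fun z : ℂ => z + 1 / 2 - (τ : ℂ) / 2) (by fun_prop)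

lemma theta_ne_zero : theta τ ≠ 0 := fun hzero => by
  have hsum : Summable fun n : ℤ => ‖exp (π * I * n ^ 2 * τ)‖ := by
    simpa [jacobiTheta₂_term] using ((summable_jacobiTheta₂_term_iff 0 τ).2 τ.im_pos).norm
  have hseries (x : ℝ) : ∑' n : ℤ, exp (π * I * n ^ 2 * τ) * exp (2 * π * I * n * x) = 0 := by
    have := congrFun hzero (x - 1 / 2 + τ / 2)
    rw [theta, show (x - 1 / 2 + τ / 2 + 1 / 2 - τ / 2 : ℂ) = x by ring] at this
    simpa [jacobiTheta₂, jacobiTheta₂_term, exp_add, mul_comm] using this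
  have hcoeff := integral_tsum_mul_exp hsum
  simp [hseries] at hcoeff

end Theta

section ThetaFunction

/-- `f` is a theta function of degree `n` for the lattice `[τ, 1]`: entire, of period `1`, and
multiplied by `c ζ⁻ⁿ` under `z ↦ z + τ`, where `ζ = exp(2πiz)`. -/
structure IsThetaFunction (τ : ℍ) (n : ℤ) (c : ℂ) (f : ℂ → ℂ) : Prop where
  differentiable : Differentiable ℂ f
  add_one : ∀ z, f (z + 1) = f z
  add_self : ∀ z, f (z + τ) = c * exp (2 * π * I * z) ^ (-n) * f z

namespace IsThetaFunction

variable {τ : ℍ} {n m : ℤ} {c d : ℂ} {f g H : ℂ → ℂ}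

lemma mul (hf : IsThetaFunction τ n c f) (hg : IsThetaFunction τ m d g) :
    IsThetaFunction τ (n + m) (c * d) fun z => f z * g z where
  differentiable := hf.differentiable.mul hg.differentiable
  add_one z := by rw [hf.add_one, hg.add_one]
  add_self z := by
    rw [hf.add_self, hg.add_self, neg_add, zpow_add₀ (exp_ne_zero _)]
    ring

lemma pow (hf : IsThetaFunction τ n c f) (k : ℕ) :
    IsThetaFunction τ (n * k) (c ^ k) fun z => f z ^ k where
  differentiable := hf.differentiable.pow k
  add_one z := by rw [hf.add_one]
  add_self z := by rw [hf.add_self, mul_pow, mul_pow, ← zpow_natCast (_ ^ _), ← zpow_mul, neg_mul]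

lemma quotient (hf : IsThetaFunction τ n c f) (hg : IsThetaFunction τ m d g)
    (hH : Differentiable ℂ H) (hfg : ∀ z, f z = g z * H z) (hg₀ : g ≠ 0) (hd : d ≠ 0) :
    IsThetaFunction τ (n - m) (c / d) H where
  differentiable := hH
  add_one z := by
    refine sub_eq_zero.1 (congrFun ((eq_zero_or_eq_zero_of_differentiable hg.differentiable
      (g := fun z => H (z + 1) - H z) (by fun_prop) fun z => ?_).resolve_left hg₀) z)
    have := hf.add_one z
    rw [hfg, hfg, hg.add_one] at this
    linear_combination this
  add_self z := by
    have hexp : Differentiable ℂ fun z : ℂ => exp (2 * π * I * z) ^ (-(n - m)) := by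
      simp only [← exp_int_mul]
      fun_prop
    refine sub_eq_zero.1 (congrFun ((eq_zero_or_eq_zero_of_differentiable hg.differentiable
      (g := fun z => H (z + τ) - c / d * exp (2 * π * I * z) ^ (-(n - m)) * H z)
      (by fun_prop) fun z => ?_).resolve_left hg₀) z)
    have hshift := hf.add_self z
    have hζ := zpow_ne_zero m (exp_ne_zero (2 * π * I * z))
    rw [hfg, hfg, hg.add_self, zpow_neg, zpow_neg] at hshift
    rw [neg_sub, zpow_sub₀ (exp_ne_zero _)]
    field_simp at hshift ⊢
    linear_combination hshift

/-- The exponential twist makes the multiplier unitary, so that Liouville's theorem applies. -/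
lemma exists_eq_mul_exp (hf : IsThetaFunction τ 0 c f) (hc : c ≠ 0) :
    ∃ a : ℂ, ∀ z, f z = f 0 * exp (a * z) := by
  set t : ℝ := Real.log ‖c‖ / τ.im
  have htτ : t * τ.im = Real.log ‖c‖ := div_mul_cancel₀ _ τ.im_ne_zero
  refine ⟨-(I * t), fun z => ?_⟩
  have hconst := eq_apply_zero_of_periodic_norm (L := periods τ)
    (f := fun z => exp (I * t * z) * f z) (by have := hf.differentiable; fun_prop)
    (fun z => ?_) (fun z => ?_) z
  · rw [mul_zero, exp_zero, one_mul] at hconst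
    rw [← hconst, mul_right_comm, ← exp_add]
    simp
  · have hunit : ‖exp (I * t * τ)‖ * ‖c‖ = 1 := by
      rw [← Real.exp_log (norm_pos_iff.2 hc), ← htτ, norm_exp, ← Real.exp_add]
      simp
    change ‖exp (I * t * (z + τ)) * f (z + τ)‖ = _
    rw [hf.add_self, mul_add, exp_add]
    simp only [neg_zero, zpow_zero, mul_one, norm_mul]
    linear_combination ‖exp (I * t * z)‖ * ‖f z‖ * hunit
  · change ‖exp (I * t * (z + 1)) * f (z + 1)‖ = _
    simp [hf.add_one, norm_exp]

end IsThetaFunction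

lemma isThetaFunction_theta (τ : ℍ) : IsThetaFunction τ 1 (-1) (theta τ) where
  differentiable := differentiable_theta τ
  add_one := theta_add_one τ
  add_self z := by rw [theta_add_self, exp_neg, zpow_neg_one, neg_one_mul]

namespace IsThetaFunction

variable {τ : ℍ} {n : ℤ} {c : ℂ} {f : ℂ → ℂ}

lemma degree_pos (hf : IsThetaFunction τ n c f) (hc : c ≠ 0) (hne : f ≠ 0) (hzero : f 0 = 0) :
    0 < n := by
  by_contra! hn
  obtain ⟨k, hk⟩ := Int.eq_ofNat_of_zero_le (neg_nonneg.2 hn)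
  have hprod := hf.mul ((isThetaFunction_theta τ).pow k)
  rw [one_mul, ← hk, add_neg_cancel] at hprod
  obtain ⟨a, ha⟩ := hprod.exists_eq_mul_exp (mul_ne_zero hc (pow_ne_zero k (by norm_num)))
  rcases eq_zero_or_eq_zero_of_differentiable hf.differentiable ((differentiable_theta τ).pow k)
    fun z => by simpa [hzero] using ha z with h | h
  · exact hne h
  · exact theta_ne_zero τ (funext fun z => eq_zero_of_pow_eq_zero (congrFun h z))

lemma degree_nonneg (hf : IsThetaFunction τ n c f) (hc : c ≠ 0) (hne : f ≠ 0) : 0 ≤ n := by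
  refine Int.lt_add_one_iff.1 <| (hf.mul (isThetaFunction_theta τ)).degree_pos
    (mul_ne_zero hc (by norm_num)) (fun h => ?_) (by simp [theta_zero])
  exact (eq_zero_or_eq_zero_of_differentiable hf.differentiable (differentiable_theta τ)
    (congrFun h)).elim hne (theta_ne_zero τ)

end IsThetaFunction

lemma exists_isThetaFunction {τ : ℍ} {α b : ℂ} {f : ℂ → ℂ} (hf : Differentiable ℂ f) (hne : f ≠ 0)
    (h₁ : ∀ z, f (z + 1) = f z) (hτ : ∀ z, f (z + τ) = b * exp (α * z) * f z) (hb : b ≠ 0) :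
    ∃ n : ℤ, α = -n * (2 * π * I) ∧ IsThetaFunction τ n b f := by
  obtain ⟨z, hz⟩ := Function.ne_iff.1 hne
  have hα : exp α = 1 := by
    have hshift := hτ (z + 1)
    rw [add_right_comm, h₁, h₁, hτ, mul_add, exp_add, mul_one] at hshift
    have hne : b * exp (α * z) * f z ≠ 0 := mul_ne_zero (mul_ne_zero hb (exp_ne_zero _)) hz
    exact mul_left_cancel₀ hne (by linear_combination -hshift)
  obtain ⟨k, rfl⟩ := exp_eq_one_iff.1 hα
  refine ⟨-k, by push_cast; ring, hf, h₁, fun z => ?_⟩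
  rw [hτ, neg_neg, ← exp_int_mul, mul_assoc (k : ℂ)]

end ThetaFunction

section Legendre

variable (τ : ℍ)

lemma psi_eq_neg_one {Λ : Submodule ℤ ℂ} {ω : ℂ} (hω : ω ∈ Λ) (hhalf : ω / 2 ∉ Λ) :
    psi Λ ω = -1 :=
  if_pos ⟨hω, fun ⟨w, hw, h⟩ => hhalf (by rwa [h, mul_div_cancel_left₀ _ two_ne_zero])⟩

lemma self_mem_lattice : (τ : ℂ) ∈ (periods τ).lattice := (periods τ).ω₁_mem_lattice

lemma one_mem_lattice : (1 : ℂ) ∈ (periods τ).lattice := (periods τ).ω₂_mem_lattice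

lemma psi_one : psi (periods τ).lattice 1 = -1 :=
  psi_eq_neg_one (one_mem_lattice τ) (periods τ).ω₂_div_two_notMem_lattice

lemma psi_self : psi (periods τ).lattice τ = -1 :=
  psi_eq_neg_one (self_mem_lattice τ) (periods τ).ω₁_div_two_notMem_lattice

/-- The function `ρ⁻¹ σ`, which has period `1` in `z`. -/
def sigmaPeriodic (z : ℂ) : ℂ := (rho τ z)⁻¹ * sigma τ z

lemma sigmaPeriodic_eq (z : ℂ) : sigmaPeriodic τ z =
    exp (π * I * z - 1 / 2 * weierstrassEta (periods τ) 1 * z ^ 2) * sigma τ z := by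
  rw [sigmaPeriodic, rho, ← exp_neg, neg_sub]

lemma differentiable_sigmaPeriodic : Differentiable ℂ (sigmaPeriodic τ) := by
  have := differentiable_weierstrassSigma (periods τ).lattice
  unfold sigmaPeriodic sigma rho
  fun_prop (disch := exact fun _ => exp_ne_zero _)

variable {τ} in
lemma sigmaPeriodic_eq_zero_iff {z : ℂ} : sigmaPeriodic τ z = 0 ↔ z ∈ (periods τ).lattice := by
  simp [sigmaPeriodic, rho, sigma, weierstrassSigma_eq_zero_iff]

lemma sigmaPeriodic_ne_zero : sigmaPeriodic τ ≠ 0 := fun h =>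
  (periods τ).ω₂_div_two_notMem_lattice (sigmaPeriodic_eq_zero_iff.1 (congrFun h _))

lemma deriv_sigmaPeriodic {z : ℂ} (hz : z ∈ (periods τ).lattice) :
    deriv (sigmaPeriodic τ) z = (rho τ z)⁻¹ * deriv (weierstrassSigma (periods τ).lattice) z := by
  have hrho : DifferentiableAt ℂ (fun z => (rho τ z)⁻¹) z := by
    unfold rho
    fun_prop (disch := exact exp_ne_zero _)
  have hsigma := differentiable_weierstrassSigma (periods τ).lattice z
  unfold sigmaPeriodic sigma
  rw [deriv_fun_mul hrho hsigma, weierstrassSigma_eq_zero_iff.2 hz, mul_zero, zero_add]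

lemma sigmaPeriodic_add_one (z : ℂ) : sigmaPeriodic τ (z + 1) = sigmaPeriodic τ z := by
  rw [sigmaPeriodic_eq, sigmaPeriodic_eq, sigma, sigma,
    weierstrassSigma_add (one_mem_lattice τ), psi_one, ← exp_pi_mul_I]
  simp only [← mul_assoc, ← exp_add]
  rw [exp_eq_exp_iff_exists_int.2 ⟨1, ?_⟩]
  push_cast
  ring

lemma sigmaPeriodic_add_self (z : ℂ) : sigmaPeriodic τ (z + τ) =
    -exp ((weierstrassEta (periods τ) τ - weierstrassEta (periods τ) 1 * τ) * (τ / 2) +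
        π * I * τ) *
      exp ((weierstrassEta (periods τ) τ - weierstrassEta (periods τ) 1 * τ) * z) *
      sigmaPeriodic τ z := by
  rw [sigmaPeriodic_eq, sigmaPeriodic_eq, sigma, sigma,
    weierstrassSigma_add (self_mem_lattice τ), psi_self]
  simp only [neg_mul, one_mul, mul_neg, ← mul_assoc, ← exp_add, neg_inj]
  congr 2
  ring

variable {τ} in
lemma theta_eq_zero_of_mem {ω : ℂ} (hω : ω ∈ (periods τ).lattice) : theta τ ω = 0 := by
  have hperiodic := periodic_of_mem_lattice (L := periods τ) (f := fun z => theta τ z = 0)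
    (fun z => by simp [periods, theta_add_self, exp_ne_zero])
    (fun z => by simp [periods, theta_add_one]) hω 0
  rw [zero_add] at hperiodic
  exact hperiodic.mpr (theta_zero τ)

lemma exists_theta_eq_sigmaPeriodic_mul :
    ∃ H : ℂ → ℂ, Differentiable ℂ H ∧ ∀ z, theta τ z = sigmaPeriodic τ z * H z := by
  refine exists_differentiable_quotient (differentiable_theta τ) (differentiable_sigmaPeriodic τ)
    fun z hz => ?_
  have hz' := sigmaPeriodic_eq_zero_iff.1 hz
  refine ⟨theta_eq_zero_of_mem hz', ?_⟩
  rw [deriv_sigmaPeriodic τ hz']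
  exact mul_ne_zero (inv_ne_zero (exp_ne_zero _)) (deriv_weierstrassSigma_ne_zero hz')

/-- `σ` has a zero, so its degree is positive; `θ / σ` is entire, so its degree is nonnegative.
Hence `σ` has the degree `1` of `θ`. -/
theorem legendre_relation :
    weierstrassEta (periods τ) τ = weierstrassEta (periods τ) 1 * τ - 2 * π * I := by
  have hb := neg_ne_zero.2 (exp_ne_zero ((weierstrassEta (periods τ) τ -
    weierstrassEta (periods τ) 1 * τ) * (τ / 2) + π * I * τ))
  obtain ⟨n, hn, hσ⟩ := exists_isThetaFunction (differentiable_sigmaPeriodic τ)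
    (sigmaPeriodic_ne_zero τ) (sigmaPeriodic_add_one τ) (sigmaPeriodic_add_self τ) hb
  obtain ⟨H, hH, hθ⟩ := exists_theta_eq_sigmaPeriodic_mul τ
  have hpos : 0 < n := hσ.degree_pos hb (sigmaPeriodic_ne_zero τ)
    (sigmaPeriodic_eq_zero_iff.2 (zero_mem _))
  have hnonneg : 0 ≤ 1 - n :=
    ((isThetaFunction_theta τ).quotient hσ hH hθ (sigmaPeriodic_ne_zero τ) hb).degree_nonneg
      (div_ne_zero (by norm_num) hb) (by
        rintro rfl
        exact theta_ne_zero τ (funext fun z => by simpa using hθ z))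
  obtain rfl : n = 1 := by lia
  push_cast at hn
  linear_combination hn

lemma isThetaFunction_sigmaPeriodic : IsThetaFunction τ 1 (-1) (sigmaPeriodic τ) where
  differentiable := differentiable_sigmaPeriodic τ
  add_one := sigmaPeriodic_add_one τ
  add_self z := by
    rw [sigmaPeriodic_add_self, legendre_relation, ← exp_int_mul, neg_one_mul,
      neg_mul (exp _), ← exp_add, ← exp_zero]
    push_cast
    ring_nf

theorem theta_eq_deriv_mul_sigmaPeriodic (z : ℂ) :
    theta τ z = deriv (theta τ) 0 * sigmaPeriodic τ z := by
  obtain ⟨H, hH, hθ⟩ := exists_theta_eq_sigmaPeriodic_mul τ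
  have hquot := (isThetaFunction_theta τ).quotient (isThetaFunction_sigmaPeriodic τ) hH hθ
    (sigmaPeriodic_ne_zero τ) (by norm_num)
  have hconst (z : ℂ) : H z = H 0 :=
    eq_apply_zero_of_periodic_norm (L := periods τ) hH
      (fun z => by simpa [periods] using congrArg norm (hquot.add_self z))
      (fun z => congrArg norm (hquot.add_one z)) z
  have hderiv : deriv (theta τ) 0 = H 0 := by
    rw [show theta τ = fun z => sigmaPeriodic τ z * H 0 from funext fun z => by rw [hθ, hconst],
      deriv_mul_const (differentiable_sigmaPeriodic τ 0),
      deriv_sigmaPeriodic τ (zero_mem _), deriv_weierstrassSigma_zero]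
    simp [rho]
  rw [hderiv, hθ, hconst, mul_comm]

lemma deriv_theta_ne_zero : deriv (theta τ) 0 ≠ 0 := fun h =>
  theta_ne_zero τ (funext fun z => by simp [theta_eq_deriv_mul_sigmaPeriodic, h])

end Legendre

section QSeries

/-- The exponent `r(r-1)/2` of `q` in the theta series; it is nonnegative, so `toNat` does not
truncate. -/
def triangle (r : ℤ) : ℕ := (r * (r - 1) / 2).toNat

lemma two_mul_triangle (r : ℤ) : 2 * (triangle r : ℤ) = r * (r - 1) := by
  have hnonneg : 0 ≤ r * (r - 1) := by
    rcases le_or_gt r 0 with h | h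
    · exact mul_nonneg_of_nonpos_of_nonpos h (by lia)
    · exact mul_nonneg h.le (by lia)
  rw [triangle, Int.toNat_of_nonneg (by lia)]
  exact Int.mul_ediv_cancel' (Int.even_mul_pred_self r).two_dvd

lemma abs_le_of_triangle_le {n : ℕ} {r : ℤ} (h : triangle r ≤ n) :
    |r| ≤ (Nat.sqrt (2 * n) + 1 : ℕ) := by
  by_contra! hlt
  set s := Nat.sqrt (2 * n)
  have hle : |r| * (|r| - 1) ≤ 2 * n := by
    rw [mul_sub_one, abs_mul_abs_self]
    linarith [two_mul_triangle r, le_abs_self r, (Nat.cast_le (α := ℤ)).2 h]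
  have hsqrt : (2 * n : ℤ) < (s + 1) * (s + 1) := mod_cast Nat.lt_succ_sqrt (2 * n)
  push_cast at hlt
  nlinarith

lemma tendsto_sqrt_two_mul_add_one_div :
    Tendsto (fun n : ℕ => ((Nat.sqrt (2 * n) + 1 : ℕ) : ℝ) / (n : ℝ)) atTop (𝓝 0) := by
  have hlim : Tendsto (fun n : ℕ => √2 * (√(n : ℝ))⁻¹ + (n : ℝ)⁻¹) atTop (𝓝 0) := by
    have hsqrt := (Real.tendsto_sqrt_atTop.comp
      tendsto_natCast_atTop_atTop).inv_tendsto_atTop.const_mul √2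
    simpa using hsqrt.add (tendsto_natCast_atTop_atTop (R := ℝ)).inv_tendsto_atTop
  refine squeeze_zero (fun n => by positivity) (fun n => ?_) hlim
  have hsqrt : (Nat.sqrt (2 * n) : ℝ) ≤ √2 * √n := by
    rw [← Real.sqrt_mul zero_le_two]
    exact_mod_cast Real.nat_sqrt_le_real_sqrt (a := 2 * n)
  calc ((Nat.sqrt (2 * n) + 1 : ℕ) : ℝ) / n ≤ (√2 * √n + 1) / n := by
        push_cast
        gcongr
    _ = √2 * (√(n : ℝ))⁻¹ + (n : ℝ)⁻¹ := by
        rw [add_div, mul_div_assoc, Real.sqrt_div_self, one_div]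

lemma jacobiTheta₂_term_eq (τ z : ℂ) (r : ℤ) :
    jacobiTheta₂_term r (z + 1 / 2 - τ / 2) τ =
      (-1) ^ r * exp (2 * π * I * τ) ^ triangle r * exp (2 * π * I * z) ^ r := by
  have htriangle : (2 * triangle r : ℂ) = r * (r - 1) := mod_cast two_mul_triangle r
  rw [jacobiTheta₂_term, ← exp_pi_mul_I, ← exp_int_mul, ← exp_int_mul, ← exp_nat_mul, ← exp_add,
    ← exp_add]
  congr 1
  linear_combination -(π * I * τ) * htriangle

variable (τ : ℍ)

lemma hasSum_theta (z : ℂ) :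
    HasSum (fun r : ℤ => (-1 : ℂ) ^ r * exp (2 * π * I * τ) ^ triangle r *
      exp (2 * π * I * z) ^ r) (theta τ z) := by
  simpa only [theta, jacobiTheta₂_term_eq] using
    hasSum_jacobiTheta₂_term (z + 1 / 2 - (τ : ℂ) / 2) τ.im_pos

lemma hasSum_deriv_theta :
    HasSum (fun r : ℤ => 2 * π * I * r * (-1 : ℂ) ^ r * exp (2 * π * I * τ) ^ triangle r)
      (deriv (theta τ) 0) := by
  have hderiv : HasDerivAt (theta τ) (jacobiTheta₂' (0 + 1 / 2 - (τ : ℂ) / 2) τ) 0 := by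
    have hcomp := HasDerivAt.comp (0 : ℂ) (hasDerivAt_jacobiTheta₂_fst _ τ.im_pos)
      (((hasDerivAt_id (0 : ℂ)).add_const (1 / 2)).sub_const ((τ : ℂ) / 2))
    rwa [mul_one] at hcomp
  rw [hderiv.deriv]
  refine (hasSum_jacobiTheta₂'_term (0 + 1 / 2 - (τ : ℂ) / 2) τ.im_pos).congr_fun fun r => ?_
  rw [jacobiTheta₂'_term, jacobiTheta₂_term_eq]
  simp only [mul_zero, exp_zero, one_zpow, mul_one]
  ring

/-- The derivative of `theta` at `z = 0`, as a function of `q`. -/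
def thetaDerivQ (q : ℂ) : ℂ := ∑' r : ℤ, 2 * π * I * r * (-1 : ℂ) ^ r * q ^ triangle r

lemma thetaDerivQ_exp : thetaDerivQ (exp (2 * π * I * τ)) = deriv (theta τ) 0 :=
  (hasSum_deriv_theta τ).tsum_eq

lemma exists_exp_eq {q : ℂ} (hq : q ≠ 0) (hq₁ : ‖q‖ < 1) : ∃ τ : ℍ, exp (2 * π * I * τ) = q := by
  have hexp : exp (2 * π * I * Function.Periodic.invQParam 1 q) = q := by
    simpa [Function.Periodic.qParam] using Function.Periodic.qParam_right_inv one_ne_zero hq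
  have him : 0 < (Function.Periodic.invQParam 1 q).im := by
    rw [Function.Periodic.im_invQParam]
    exact mul_pos_of_neg_of_neg (div_neg_of_neg_of_pos (by norm_num) Real.two_pi_pos)
      (Real.log_neg (norm_pos_iff.2 hq) hq₁)
  exact ⟨⟨_, him⟩, hexp⟩

lemma differentiableOn_thetaDerivQ : DifferentiableOn ℂ thetaDerivQ (Metric.ball 0 1) := by
  intro q hq
  obtain ⟨s, hqs, hs⟩ := exists_between (mem_ball_zero_iff.1 hq)
  have hs₀ : 0 < s := (norm_nonneg q).trans_lt hqs
  have hnorm : ‖(s : ℂ)‖ = s := by rw [norm_real, Real.norm_of_nonneg hs₀.le]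
  obtain ⟨τ, hτ⟩ := exists_exp_eq (ofReal_ne_zero.2 hs₀.ne') (hnorm.trans_lt hs)
  have hsum := hτ ▸ (hasSum_deriv_theta τ).summable.norm
  have hdiff : DifferentiableOn ℂ thetaDerivQ (Metric.ball 0 s) := by
    refine differentiableOn_tsum_of_summable_norm hsum (fun r => by fun_prop) Metric.isOpen_ball
      fun r w hw => ?_
    rw [norm_mul, norm_mul _ ((s : ℂ) ^ triangle r), norm_pow, norm_pow, hnorm]
    gcongr
    exact (mem_ball_zero_iff.1 hw).le
  exact (hdiff.differentiableAt (Metric.isOpen_ball.mem_nhds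
    (mem_ball_zero_iff.2 hqs))).differentiableWithinAt

lemma thetaDerivQ_zero : thetaDerivQ 0 = -(2 * π * I) := by
  rw [thetaDerivQ, tsum_eq_single 1]
  · simp [triangle]
  · intro r hr
    rcases eq_or_ne r 0 with rfl | hr₀
    · simp
    · have htriangle : triangle r ≠ 0 := fun h => by
        have := two_mul_triangle r
        rw [h, Nat.cast_zero, mul_zero] at this
        exact mul_ne_zero hr₀ (sub_ne_zero.2 hr) this.symm
      simp [htriangle]

lemma thetaDerivQ_ne_zero {q : ℂ} (hq : ‖q‖ < 1) : thetaDerivQ q ≠ 0 := by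
  rcases eq_or_ne q 0 with rfl | hq₀
  · rw [thetaDerivQ_zero]
    exact neg_ne_zero.2 two_pi_I_ne_zero
  · obtain ⟨τ, rfl⟩ := exists_exp_eq hq₀ hq
    rw [thetaDerivQ_exp]
    exact deriv_theta_ne_zero τ

lemma exists_hasSum_inv_deriv_theta : ∃ p : ℕ → ℂ, ∀ τ : ℍ,
    HasSum (fun n => p n * exp (2 * π * I * τ) ^ n) (deriv (theta τ) 0)⁻¹ := by
  have hdiff : DifferentiableOn ℂ (fun q => (thetaDerivQ q)⁻¹) (Metric.ball 0 ((1 : NNReal) : ℝ)) :=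
    differentiableOn_thetaDerivQ.inv fun q hq => thetaDerivQ_ne_zero (mem_ball_zero_iff.1 hq)
  refine ⟨fun n => (n.factorial : ℂ)⁻¹ * iteratedDeriv n (fun q => (thetaDerivQ q)⁻¹) 0,
    fun τ => ?_⟩
  have htaylor := hasSum_taylorSeries_on_ball hdiff (z := exp (2 * π * I * τ))
    (by simpa using UpperHalfPlane.norm_exp_two_pi_I_lt_one τ)
  rw [thetaDerivQ_exp] at htaylor
  refine htaylor.congr_fun fun n => ?_
  rw [smul_eq_mul, smul_eq_mul, sub_zero]
  ring

end QSeries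

section Fourier

variable (τ : ℍ)

lemma sigmaPeriodic_eq_inv_deriv_mul_theta (z : ℂ) :
    sigmaPeriodic τ z = (deriv (theta τ) 0)⁻¹ * theta τ z := by
  rw [theta_eq_deriv_mul_sigmaPeriodic τ z, inv_mul_cancel_left₀ (deriv_theta_ne_zero τ)]

theorem hasFourierDevelopment_sigmaPeriodic : HasFourierDevelopment sigmaPeriodic := by
  obtain ⟨p, hp⟩ := exists_hasSum_inv_deriv_theta
  refine ⟨fun n => Nat.sqrt (2 * n) + 1,
    fun n r => if triangle r ≤ n then p (n - triangle r) * (-1) ^ r else 0, fun m n h => ?_,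
    tendsto_sqrt_two_mul_add_one_div,
    fun n r h => if_neg fun hle => (abs_le_of_triangle_le hle).not_gt h, fun τ z => ?_⟩
  · dsimp only
    gcongr
  have hinj : Function.Injective fun x : ℕ × ℤ => (x.1 + triangle x.2, x.2) := by
    rintro ⟨m, r⟩ ⟨n, s⟩ h
    simp only [Prod.mk.injEq] at h
    obtain ⟨h, rfl⟩ := h
    rw [Nat.add_right_cancel h]
  have hsummable := summable_mul_of_summable_norm (hp τ).summable.norm
    (hasSum_theta τ z).summable.norm
  have hprod := (hp τ).mul (hasSum_theta τ z) hsummable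
  rw [← sigmaPeriodic_eq_inv_deriv_mul_theta] at hprod
  refine (hinj.hasSum_iff ?_).1 (hprod.congr_fun fun x => ?_)
  · rintro ⟨n, r⟩ hx
    have hlt : ¬ triangle r ≤ n := fun hle =>
      hx ⟨(n - triangle r, r), by simp [Nat.sub_add_cancel hle]⟩
    simp only [hlt, if_false, zero_mul]
  · simp only [Function.comp_apply, le_add_iff_nonneg_left, zero_le, if_true,
      Nat.add_sub_cancel, pow_add]
    ring

end Fourier

section Holomorphy

lemma weierstrassEta_one_eq_two_mul (τ : ℍ) :
    weierstrassEta (periods τ) 1 = 2 * weierstrassZeta (periods τ).lattice (1 / 2) := by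
  have hhalf : (1 / 2 : ℂ) ∉ (periods τ).lattice := (periods τ).ω₂_div_two_notMem_lattice
  have hadd := weierstrassZeta_add (one_mem_lattice τ) (z := -(1 / 2)) (neg_mem_iff.not.2 hhalf)
  rw [weierstrassZeta_neg, show -(1 / 2 : ℂ) + 1 = 1 / 2 by norm_num] at hadd
  linear_combination -hadd

lemma tsum_lattice_eq (τ : ℍ) (f : ℂ → ℂ) :
    ∑' l : (periods τ).lattice, f l = ∑' x : Fin 2 → ℤ, f (x 0 * τ + x 1) := by
  rw [← ((finTwoArrowEquiv ℤ).trans (periods τ).latticeEquivProd.symm.toEquiv).tsum_eq]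
  refine tsum_congr fun x => congrArg f ?_
  exact ((periods τ).latticeEquiv_symm_apply (x 0, x 1)).trans
    (congrArg (x 0 * (τ : ℂ) + ·) (mul_one _))

lemma weierstrassEta_one_eq_tsum (τ : ℍ) : weierstrassEta (periods τ) 1 =
    2 * ∑' x : Fin 2 → ℤ, zetaTerm (1 / 2) (x 0 * τ + x 1) := by
  have hhalf : (1 / 2 : ℂ) ∉ (periods τ).lattice := (periods τ).ω₂_div_two_notMem_lattice
  rw [weierstrassEta_one_eq_two_mul, ← tsum_lattice_eq τ (zetaTerm (1 / 2)),
    weierstrassZeta_eq_tsum hhalf]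

lemma differentiableAt_zetaTerm_half (x : Fin 2 → ℤ) (τ : ℍ) :
    DifferentiableAt ℂ (fun t : ℂ => zetaTerm (1 / 2) (x 0 * t + x 1)) τ := by
  unfold zetaTerm
  rcases eq_or_ne x 0 with rfl | hx
  · simp
  · have hne : (x 0 * τ + x 1 : ℂ) ≠ 0 :=
      norm_pos_iff.1 ((mul_pos (EisensteinSeries.r_pos τ) (norm_pos_iff.2 hx)).trans_le
        (EisensteinSeries.r_mul_max_le τ hx))
    have hmem : (x 0 * τ + x 1 : ℂ) ∈ (periods τ).lattice :=
      PeriodPair.mem_lattice.2 ⟨x 0, x 1, by simp [periods]⟩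
    have hne_half : (1 / 2 - (x 0 * τ + x 1) : ℂ) ≠ 0 :=
      sub_ne_zero.2 (ne_of_mem_of_not_mem hmem (periods τ).ω₂_div_two_notMem_lattice).symm
    have hsq : (x 0 * τ + x 1 : ℂ) ^ 2 ≠ 0 := pow_ne_zero 2 hne
    fun_prop (disch := assumption)

lemma summableLocallyUniformlyOn_zetaTerm_half :
    SummableLocallyUniformlyOn (fun (x : Fin 2 → ℤ) (t : ℂ) => zetaTerm (1 / 2) (x 0 * t + x 1))
      {t | 0 < t.im} := by
  refine .of_locally_bounded_eventually UpperHalfPlane.isOpen_upperHalfPlaneSet fun K hK hKc => ?_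
  lift K to Set ℍ using hK
  obtain ⟨A, B, hB, hAB⟩ := UpperHalfPlane.subset_verticalStrip_of_isCompact
    (UpperHalfPlane.isEmbedding_coe.isCompact_iff.2 hKc)
  set s := EisensteinSeries.r ⟨⟨A, B⟩, hB⟩
  have hs : 0 < s := EisensteinSeries.r_pos _
  refine ⟨fun x => 2 * (1 / 2) ^ 2 * (s ^ (-3 : ℝ) * ‖x‖ ^ (-3 : ℝ)),
    ((EisensteinSeries.summable_one_div_norm_rpow (by norm_num)).mul_left _).mul_left _, ?_⟩
  have hnorm : Tendsto (fun x : Fin 2 → ℤ => ‖x‖) cofinite atTop :=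
    cocompact_eq_cofinite (Fin 2 → ℤ) ▸ tendsto_norm_cocompact_atTop
  filter_upwards [hnorm.eventually_ge_atTop s⁻¹] with x hx
  rintro _ ⟨τ, hτ, rfl⟩
  have hx₀ : x ≠ 0 := norm_pos_iff.1 ((inv_pos.2 hs).trans_le hx)
  have hle : 1 ≤ ‖(x 0 * τ + x 1 : ℂ)‖ := calc
    1 ≤ s * ‖x‖ := (inv_le_iff_one_le_mul₀' hs).1 hx
    _ ≤ EisensteinSeries.r τ * ‖x‖ := by
      gcongr
      exact EisensteinSeries.r_lower_bound_on_verticalStrip τ hB (hAB hτ)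
    _ ≤ ‖(x 0 * τ + x 1 : ℂ)‖ := EisensteinSeries.r_mul_max_le τ hx₀
  refine (norm_zetaTerm_le one_half_pos (by norm_num) (by linarith)).trans ?_
  gcongr
  exact EisensteinSeries.summand_bound_of_mem_verticalStrip (by norm_num) x hB (hAB hτ)

lemma differentiableOn_weierstrassEta_one : DifferentiableOn ℂ
    (fun t : ℂ => weierstrassEta (periods (UpperHalfPlane.ofComplex t)) 1) {t | 0 < t.im} := by
  refine ((summableLocallyUniformlyOn_zetaTerm_half.differentiableOn
    UpperHalfPlane.isOpen_upperHalfPlaneSet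
    fun x t ht => differentiableAt_zetaTerm_half x ⟨t, ht⟩).const_mul 2).congr fun t ht => ?_
  rw [weierstrassEta_one_eq_tsum, UpperHalfPlane.ofComplex_apply_of_im_pos ht]

theorem isHolomorphic_sigmaPeriodic : IsHolomorphic sigmaPeriodic := by
  have htheta : DifferentiableOn ℂ (fun p : ℂ × ℂ => theta p.1 p.2) {p | 0 < p.1.im} := by
    intro p hp
    exact ((hasFDerivAt_jacobiTheta₂ (p.2 + 1 / 2 - p.1 / 2) hp).differentiableAt.comp p
      (f := fun p : ℂ × ℂ => (p.2 + 1 / 2 - p.1 / 2, p.1))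
      (by fun_prop)).differentiableWithinAt
  have hnorm (p : ℂ × ℂ) (hp : 0 < p.1.im) : ‖exp (2 * π * I * p.1)‖ < 1 :=
    UpperHalfPlane.norm_exp_two_pi_I_lt_one ⟨p.1, hp⟩
  have hderiv : DifferentiableOn ℂ (fun p : ℂ × ℂ => thetaDerivQ (exp (2 * π * I * p.1)))
      {p | 0 < p.1.im} :=
    differentiableOn_thetaDerivQ.comp (f := fun p : ℂ × ℂ => exp (2 * π * I * p.1))
      (by fun_prop) fun p hp => mem_ball_zero_iff.2 (hnorm p hp)
  refine ((hderiv.inv fun p hp => thetaDerivQ_ne_zero (hnorm p hp)).mul htheta).congr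
    fun p hp => ?_
  rw [sigmaPeriodic_eq_inv_deriv_mul_theta, ← thetaDerivQ_exp,
    UpperHalfPlane.ofComplex_apply_of_im_pos hp]
  rfl

lemma sigma_eq_rho_mul_sigmaPeriodic (τ : ℍ) (z : ℂ) :
    sigma τ z = rho τ z * sigmaPeriodic τ z :=
  (mul_inv_cancel_left₀ (exp_ne_zero _) _).symm

theorem isHolomorphic_sigma : IsHolomorphic sigma := by
  have heta : DifferentiableOn ℂ (fun p : ℂ × ℂ =>
      weierstrassEta (periods (UpperHalfPlane.ofComplex p.1)) 1) {p | 0 < p.1.im} :=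
    differentiableOn_weierstrassEta_one.comp differentiableOn_fst fun p hp => hp
  have hrho : IsHolomorphic rho := by
    unfold IsHolomorphic rho
    fun_prop
  exact (hrho.mul isHolomorphic_sigmaPeriodic).congr fun p _ => sigma_eq_rho_mul_sigmaPeriodic _ _

end Holomorphy

section Modular

variable (M : SL(2, ℤ)) (τ : ℍ)

lemma mem_lattice_periods {τ : ℍ} {w : ℂ} :
    w ∈ (periods τ).lattice ↔ ∃ m n : ℤ, (m * τ + n : ℂ) = w := by
  rw [PeriodPair.mem_lattice]
  simp [periods]

lemma automorphy_ne_zero : (M 1 0 * τ + M 1 1 : ℂ) ≠ 0 := by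
  simpa [UpperHalfPlane.denom] using UpperHalfPlane.denom_ne_zero (M : GL (Fin 2) ℝ) τ

lemma automorphy_mul_coe_smul :
    (M 1 0 * τ + M 1 1 : ℂ) * (M • τ : ℍ) = M 0 0 * τ + M 0 1 := by
  rw [UpperHalfPlane.coe_specialLinearGroup_apply]
  exact mul_div_cancel₀ _ (automorphy_ne_zero M τ)

lemma mem_lattice_smul_iff (w : ℂ) : w ∈ (periods (M • τ)).lattice ↔
    (M 1 0 * τ + M 1 1 : ℂ) * w ∈ (periods τ).lattice := by
  have hsmul := automorphy_mul_coe_smul M τ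
  have hdet : (M 0 0 * M 1 1 - M 0 1 * M 1 0 : ℂ) = 1 :=
    mod_cast M.val.det_fin_two.symm.trans M.det_coe
  rw [mem_lattice_periods, mem_lattice_periods]
  constructor
  · rintro ⟨m, n, rfl⟩
    refine ⟨m * M 0 0 + n * M 1 0, m * M 0 1 + n * M 1 1, ?_⟩
    push_cast
    linear_combination -m * hsmul
  · rintro ⟨m, n, h⟩
    refine ⟨m * M 1 1 - n * M 1 0, n * M 0 0 - m * M 0 1,
      mul_left_cancel₀ (automorphy_ne_zero M τ) ?_⟩
    push_cast
    linear_combination (m * M 1 1 - n * M 1 0 : ℂ) * hsmul + (m * τ + n) * hdet + h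

lemma coe_real_smul : (M : SL(2, ℝ)) • τ = M • τ := by
  ext
  rw [UpperHalfPlane.coe_specialLinearGroup_apply, UpperHalfPlane.coe_specialLinearGroup_apply]
  simp

theorem slash'_sigma : slash' (-1) sigma (M : SL(2, ℝ)) = sigma := by
  ext τ z
  have hmul := weierstrassSigma_mul (automorphy_ne_zero M τ) (mem_lattice_smul_iff M τ)
    (z / (M 1 0 * τ + M 1 1 : ℂ))
  rw [mul_div_cancel₀ _ (automorphy_ne_zero M τ)] at hmul
  rw [slash', coe_real_smul, neg_neg, zpow_one]
  exact hmul.symm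

theorem slash''_sigma (a b : ℤ) : slash'' (-1) sigma a b = sigma := by
  ext τ z
  have hω : (a * τ + b : ℂ) ∈ (periods τ).lattice := mem_lattice_periods.2 ⟨a, b, rfl⟩
  simp only [slash'', sigma, ofReal_intCast]
  rw [weierstrassSigma_add hω z, zpow_neg_one,
    inv_mul_cancel_left₀ (mul_ne_zero (psi_ne_zero _ _) (exp_ne_zero _))]

theorem sigma_mem_J : sigma ∈ J (-1) (⊤ : Subgroup SL(2, ℤ)) where
  holomorphic := isHolomorphic_sigma
  slash'_eq M _ := slash'_sigma M
  slash''_eq := slash''_sigma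
  fourier M := by
    simp only [slash'_sigma, zpow_neg_one]
    exact hasFourierDevelopment_sigmaPeriodic

end Modular

section Klein

theorem slash''_sigma_zero (a b : ℝ) (τ : ℍ) : slash'' (-1) sigma a b τ 0 = kleinForm a b τ := by
  rw [slash'', kleinForm, zpow_neg_one, mul_inv, psi_inv, ← exp_neg]
  ring_nf

lemma weierstrassEta_periods (a b : ℝ) (τ : ℍ) : weierstrassEta (periods τ) (a * τ + b) =
    weierstrassEta (periods τ) 1 * (a * τ + b) - 2 * π * I * a := by
  have hb : weierstrassEta (periods τ) b = b * weierstrassEta (periods τ) 1 := by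
    rw [← weierstrassEta_ofReal_mul, mul_one]
  rw [weierstrassEta_add, weierstrassEta_ofReal_mul, hb, legendre_relation]
  ring

/-- Off the zeros of `σ` the sign `ψ` is `1`. -/
lemma kleinForm_eq_exp_mul_sigma (a b : ℝ) (τ : ℍ) : kleinForm a b τ =
    exp (-(1 / 2) * weierstrassEta (periods τ) (a * τ + b) * (a * τ + b)) *
      sigma τ (a * τ + b) := by
  by_cases h : (a * τ + b : ℂ) ∈ (periods τ).lattice
  · rw [kleinForm, sigma, weierstrassSigma_eq_zero_iff.2 h, mul_zero, mul_zero]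
  · rw [kleinForm, psi, if_neg fun hmem => h hmem.1, one_mul]

lemma kleinForm_eq_exp_mul_sigmaPeriodic (a b : ℝ) (τ : ℍ) : kleinForm a b τ =
    exp (π * I * (a - 1) * (a * τ + b)) * sigmaPeriodic τ (a * τ + b) := by
  rw [kleinForm_eq_exp_mul_sigma, weierstrassEta_periods, sigma_eq_rho_mul_sigmaPeriodic, rho,
    ← mul_assoc, ← exp_add]
  congr 2
  ring

lemma mdifferentiable_kleinForm (a b : ℝ) : MDifferentiable 𝓘(ℂ) 𝓘(ℂ) (kleinForm a b) := by
  rw [UpperHalfPlane.mdifferentiable_iff]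
  have hexp : DifferentiableOn ℂ (fun t : ℂ => exp (π * I * (a - 1) * (a * t + b)))
      {t | 0 < t.im} := by fun_prop
  have hsigma : DifferentiableOn ℂ
      (fun t : ℂ => sigmaPeriodic (UpperHalfPlane.ofComplex t) (a * t + b)) {t | 0 < t.im} :=
    isHolomorphic_sigmaPeriodic.comp (f := fun t : ℂ => (t, (a * t + b : ℂ))) (by fun_prop)
      fun _ ht => ht
  refine (hexp.mul hsigma).congr fun t ht => ?_
  rw [Function.comp_apply, kleinForm_eq_exp_mul_sigmaPeriodic, Pi.mul_apply,
    UpperHalfPlane.ofComplex_apply_of_im_pos ht]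

lemma kleinForm_smul (M : SL(2, ℤ)) (a b : ℝ) (τ : ℍ) :
    (M 1 0 * τ + M 1 1 : ℂ) * kleinForm a b (M • τ) =
      kleinForm (a * M 0 0 + b * M 1 0) (a * M 0 1 + b * M 1 1) τ := by
  have hj := automorphy_ne_zero M τ
  have hΛ := mem_lattice_smul_iff M τ
  have hz : ((a * M 0 0 + b * M 1 0 : ℝ) : ℂ) * τ + ((a * M 0 1 + b * M 1 1 : ℝ) : ℂ) =
      (M 1 0 * τ + M 1 1) * (a * (M • τ : ℍ) + b) := by
    push_cast
    linear_combination -a * automorphy_mul_coe_smul M τ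
  rw [kleinForm, kleinForm, psi_mul hj hΛ, weierstrassEta_mul hj hΛ, hz, sigma, sigma,
    weierstrassSigma_mul hj hΛ]
  ring_nf

lemma kleinForm_slash (M : SL(2, ℤ)) (a b : ℝ) : kleinForm a b ∣[(-1 : ℤ)] M =
    kleinForm (a * M 0 0 + b * M 1 0) (a * M 0 1 + b * M 1 1) := by
  ext τ
  rw [ModularForm.SL_slash_apply, ← kleinForm_smul, mul_comm]
  simp [UpperHalfPlane.denom]

lemma kleinForm_add (a b : ℝ) (m n : ℤ) (τ : ℍ) : kleinForm (a + m) (b + n) τ =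
    psi (periods τ).lattice (m * τ + n) * exp (π * I * (a * n - b * m)) * kleinForm a b τ := by
  set z : ℂ := a * τ + b with hz
  set w : ℂ := m * τ + n with hw
  have hzw : ((a + m : ℝ) : ℂ) * τ + ((b + n : ℝ) : ℂ) = z + w := by
    rw [hz, hw]
    push_cast
    ring
  have hηz : weierstrassEta (periods τ) z = weierstrassEta (periods τ) 1 * z - 2 * π * I * a :=
    weierstrassEta_periods a b τ
  have hηw : weierstrassEta (periods τ) w = weierstrassEta (periods τ) 1 * w - 2 * π * I * m :=
    mod_cast weierstrassEta_periods m n τ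
  have hexp : exp (-(1 / 2) * weierstrassEta (periods τ) (z + w) * (z + w)) *
      exp (weierstrassEta (periods τ) w * (z + 1 / 2 * w)) =
      exp (π * I * (a * n - b * m)) * exp (-(1 / 2) * weierstrassEta (periods τ) z * z) := by
    rw [weierstrassEta_add, hηz, hηw, hz, hw, ← exp_add, ← exp_add]
    congr 1
    ring
  rw [kleinForm_eq_exp_mul_sigma, kleinForm_eq_exp_mul_sigma, hzw, ← hz, sigma, sigma,
    weierstrassSigma_add (mem_lattice_periods.2 ⟨m, n, rfl⟩)]
  linear_combination psi (periods τ).lattice w * weierstrassSigma (periods τ).lattice z * hexp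

lemma kleinForm_add_two_mul {a b : ℝ} {m n k : ℤ} (hk : a * n - b * m = k) :
    kleinForm (a + (2 * m : ℤ)) (b + (2 * n : ℤ)) = kleinForm a b := by
  ext τ
  have hpsi : psi (periods τ).lattice ((2 * m : ℤ) * τ + (2 * n : ℤ)) = 1 := by
    convert psi_two_mul (mem_lattice_periods.2 ⟨m, n, rfl⟩) using 2
    push_cast
    ring
  have hexp : exp (π * I * (a * (2 * n : ℤ) - b * (2 * m : ℤ))) = 1 := by
    rw [exp_eq_one_iff]
    have hk' : (a * n - b * m : ℂ) = k := mod_cast hk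
    exact ⟨k, by push_cast; linear_combination 2 * π * I * hk'⟩
  rw [kleinForm_add, hpsi, hexp, one_mul, one_mul]

lemma kleinForm_slash_of_mem_Gamma {N : ℕ} (hN : 1 ≤ N) (a b : ℤ) {M : SL(2, ℤ)}
    (hM : M ∈ CongruenceSubgroup.Gamma (2 * N ^ 2)) :
    kleinForm ((a : ℝ) / N) ((b : ℝ) / N) ∣[(-1 : ℤ)] M =
      kleinForm ((a : ℝ) / N) ((b : ℝ) / N) := by
  have exists_eq_add_mul {x y : ℤ} (h : (x : ZMod (2 * N ^ 2)) = y) :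
      ∃ u : ℤ, x = y + 2 * N ^ 2 * u := by
    obtain ⟨u, hu⟩ := (ZMod.intCast_eq_intCast_iff_dvd_sub y x _).1 h.symm
    push_cast at hu
    exact ⟨u, by linear_combination hu⟩
  obtain ⟨h₀₀, h₀₁, h₁₀, h₁₁⟩ := CongruenceSubgroup.Gamma_mem.1 hM
  obtain ⟨s, hs⟩ := exists_eq_add_mul (y := 1) (by simpa using h₀₀)
  obtain ⟨t, ht⟩ := exists_eq_add_mul (y := 0) (by simpa using h₀₁)
  obtain ⟨u, hu⟩ := exists_eq_add_mul (y := 0) (by simpa using h₁₀)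
  obtain ⟨v, hv⟩ := exists_eq_add_mul (y := 1) (by simpa using h₁₁)
  have hN₀ : (N : ℝ) ≠ 0 := by positivity
  have hpairing : (a : ℝ) / N * (N * (a * t + b * v) : ℤ) - b / N * (N * (a * s + b * u) : ℤ) =
      (a * (a * t + b * v) - b * (a * s + b * u) : ℤ) := by
    push_cast
    field_simp
  rw [kleinForm_slash, ← kleinForm_add_two_mul hpairing, hs, ht, hu, hv]
  push_cast
  congr 1 <;> field_simp <;> ring

end Klein

section Cusps

lemma hasSum_tsum_fiber_mul_zpow {ι 𝕜 : Type*} [NormedField 𝕜] [CompleteSpace 𝕜] {d : ι → 𝕜}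
    {E : ι → ℤ} {m : ℤ} (hE : ∀ i, d i ≠ 0 → m ≤ E i) {Q s : 𝕜}
    (h : HasSum (fun i => d i * Q ^ E i) s) :
    HasSum (fun n : ℕ => (∑' i : {i // (E i - m).toNat = n}, d i) * Q ^ (m + n : ℤ)) s := by
  have hsum : HasSum (fun i => d i * Q ^ (m + (E i - m).toNat : ℤ)) s := by
    refine h.congr_fun fun i => ?_
    by_cases hi : d i = 0
    · simp only [hi, zero_mul]
    · rw [Int.toNat_of_nonneg (by linarith [hE i hi]), add_sub_cancel]
  refine ((Equiv.sigmaFiberEquiv fun i => (E i - m).toNat).hasSum_iff.2 hsum).sigma fun n => ?_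
  have hterm (i : {i // (E i - m).toNat = n}) :
      d i * Q ^ (m + n : ℤ) = d i * Q ^ (m + (E i - m).toNat : ℤ) := by
    rw [i.2]
  have hfiber : Summable fun i : {i // (E i - m).toNat = n} => d i * Q ^ (m + n : ℤ) :=
    (hsum.summable.subtype {i | (E i - m).toNat = n}).congr fun i => (hterm i).symm
  rw [← tsum_mul_right]
  exact hfiber.hasSum.congr_fun fun i => (hterm i).symm

/-- `f` is the sum on all of `ℍ` of a Laurent series in `exp(2πiτ/h)` with finite principal part,
i.e. `f` is meromorphic at `∞` in the local parameter of width `h`. -/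
def HasLaurentExpansion (h : ℕ) (f : ℍ → ℂ) : Prop :=
  ∃ (m : ℤ) (a : ℕ → ℂ), ∀ τ : ℍ,
    HasSum (fun n : ℕ => a n * exp (2 * π * I * τ / h) ^ (m + n : ℤ)) (f τ)

lemma hasLaurentExpansion_of_hasSum {ι : Type*} {h : ℕ} {f : ℍ → ℂ} {d : ι → ℂ} {E : ι → ℤ}
    {m : ℤ} (hE : ∀ i, d i ≠ 0 → m ≤ E i)
    (hf : ∀ τ : ℍ, HasSum (fun i => d i * exp (2 * π * I * τ / h) ^ E i) (f τ)) :
    HasLaurentExpansion h f :=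
  ⟨m, _, fun τ => hasSum_tsum_fiber_mul_zpow hE (hf τ)⟩

namespace HasLaurentExpansion

variable {h : ℕ} {f : ℍ → ℂ}

lemma mul_width (hf : HasLaurentExpansion h f) {k : ℕ} (hk : k ≠ 0) :
    HasLaurentExpansion (h * k) f := by
  obtain ⟨m, a, ha⟩ := hf
  refine hasLaurentExpansion_of_hasSum (d := a) (E := fun n => k * (m + n)) (m := k * m)
    (fun n _ => by gcongr; lia) fun τ => ?_
  have hroot : exp (2 * π * I * τ / (h * k : ℕ)) ^ k = exp (2 * π * I * τ / h) := by
    rw [← exp_nat_mul]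
    push_cast
    field_simp
  simpa only [zpow_mul, zpow_natCast, hroot] using ha τ

lemma const_mul_zpow_mul (hf : HasLaurentExpansion h f) (c : ℂ) (j : ℤ) :
    HasLaurentExpansion h fun τ => c * exp (2 * π * I * τ / h) ^ j * f τ := by
  obtain ⟨m, a, ha⟩ := hf
  refine ⟨j + m, fun n => c * a n, fun τ =>
    ((ha τ).mul_left (c * exp (2 * π * I * τ / h) ^ j)).congr_fun fun n => ?_⟩
  rw [add_assoc, zpow_add₀ (exp_ne_zero _) j]
  ring

end HasLaurentExpansion

lemma exists_forall_le_mul_add_mul {r₀ : ℕ → ℕ} (hmono : Monotone r₀)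
    (hlim : Tendsto (fun n : ℕ => (r₀ n : ℝ) / (n : ℝ)) atTop (𝓝 0)) {N : ℕ} (hN : 1 ≤ N) (A : ℤ) :
    ∃ m : ℤ, ∀ (n : ℕ) (r : ℤ), |r| ≤ r₀ n → m ≤ N * n + A * r := by
  have hpos : (0 : ℝ) < 1 / (|A| + 1 : ℤ) := by positivity
  obtain ⟨n₀, hn₀⟩ := eventually_atTop.1
    ((hlim.eventually_lt_const hpos).and (eventually_gt_atTop 0))
  refine ⟨-(|A| * r₀ n₀), fun n r hr => ?_⟩
  have hAr : -(|A| * r₀ n) ≤ A * r := calc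
    -(|A| * r₀ n) ≤ -(|A| * |r|) := by gcongr
    _ = -|A * r| := by rw [abs_mul]
    _ ≤ A * r := neg_abs_le _
  have hNn : (n : ℤ) ≤ N * n := le_mul_of_one_le_left (by positivity) (mod_cast hN)
  rcases le_total n₀ n with hn | hn
  · obtain ⟨hlt, hn_pos⟩ := hn₀ n hn
    rw [div_lt_div_iff₀ (mod_cast hn_pos) (by positivity), one_mul] at hlt
    have hlarge : (r₀ n : ℤ) * (|A| + 1) < n := mod_cast hlt
    have hnonneg : 0 ≤ |A| * r₀ n₀ := by positivity
    nlinarith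
  · have hsmall : |A| * r₀ n ≤ |A| * r₀ n₀ := by
      gcongr
      exact hmono hn
    linarith

lemma HasFourierDevelopment.hasLaurentExpansion {f : ℍ → ℂ → ℂ} (hf : HasFourierDevelopment f)
    {N : ℕ} (hN : 1 ≤ N) (A B : ℤ) :
    HasLaurentExpansion N fun τ => f τ (A / N * τ + B / N) := by
  obtain ⟨r₀, c, hmono, hlim, hc, hsum⟩ := hf
  obtain ⟨m, hm⟩ := exists_forall_le_mul_add_mul hmono hlim hN A
  refine hasLaurentExpansion_of_hasSum
    (d := fun p : ℕ × ℤ => c p.1 p.2 * exp (2 * π * I * (B / N)) ^ p.2)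
    (E := fun p => N * p.1 + A * p.2) (m := m) (fun p hp => hm p.1 p.2 ?_) fun τ => ?_
  · by_contra! hlt
    exact hp (by simp only [hc p.1 p.2 hlt, zero_mul])
  · have hN₀ : (N : ℂ) ≠ 0 := Nat.cast_ne_zero.2 (Nat.one_le_iff_ne_zero.1 hN)
    have hq : exp (2 * π * I * τ) = exp (2 * π * I * τ / N) ^ N := by
      rw [← exp_nat_mul, mul_div_cancel₀ _ hN₀]
    have hζ : exp (2 * π * I * (A / N * τ + B / N)) =
        exp (2 * π * I * τ / N) ^ A * exp (2 * π * I * (B / N)) := by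
      rw [← exp_int_mul, ← exp_add]
      congr 1
      ring
    refine (hsum τ _).congr_fun fun p => ?_
    rw [hq, hζ, mul_zpow, zpow_add₀ (exp_ne_zero _), zpow_mul, zpow_mul, zpow_natCast,
      zpow_natCast]
    ring

lemma hasLaurentExpansion_kleinForm {N : ℕ} (hN : 1 ≤ N) (A B : ℤ) :
    HasLaurentExpansion (2 * N ^ 2) (kleinForm ((A : ℝ) / N) ((B : ℝ) / N)) := by
  have hN₀ : (N : ℂ) ≠ 0 := Nat.cast_ne_zero.2 (Nat.one_le_iff_ne_zero.1 hN)
  have hsigma := ((hasFourierDevelopment_sigmaPeriodic.hasLaurentExpansion hN A B).mul_width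
    (k := 2 * N) (by positivity)).const_mul_zpow_mul
      (exp (π * I * (A / N - 1) * (B / N))) ((A - N) * A)
  rw [show 2 * N ^ 2 = N * (2 * N) by ring]
  convert hsigma using 2 with τ
  rw [kleinForm_eq_exp_mul_sigmaPeriodic, ← exp_int_mul, ← exp_add]
  push_cast
  congr 2
  field_simp
  ring

theorem isNearlyHolomorphicModularForm_kleinForm {N : ℕ} (hN : 1 ≤ N) (a b : ℤ) :
    IsNearlyHolomorphicModularForm (-1) (CongruenceSubgroup.Gamma (2 * N ^ 2))
      (kleinForm ((a : ℝ) / N) ((b : ℝ) / N)) where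
  holomorphic := mdifferentiable_kleinForm _ _
  slash_eq _ := kleinForm_slash_of_mem_Gamma hN a b
  meromorphic_at_cusps M := by
    have hcombination (x y : ℤ) :
        (a : ℝ) / N * x + b / N * y = ((a * x + b * y : ℤ) : ℝ) / N := by
      push_cast
      ring
    rw [kleinForm_slash, hcombination, hcombination]
    exact ⟨2 * N ^ 2, (hasLaurentExpansion_kleinForm hN _ _).imp fun _ => Exists.imp fun _ ha =>
      ⟨by positivity, ha⟩⟩

end Cusps

end ModifiedJacobi

end

theorem theorem3p4 :
    -- the Weierstrass product converges, and `η` is the additive quasi-period of `ζ`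
    ((∀ (τ : ℍ) (z : ℂ), Multipliable
        fun ω : ↥(((ModifiedJacobi.periods τ).lattice : Set ℂ) \ {0}) =>
          ModifiedJacobi.sigmaFactor z ω) ∧
      (∀ (τ : ℍ), ∀ ω ∈ (ModifiedJacobi.periods τ).lattice,
        ∀ z ∉ (ModifiedJacobi.periods τ).lattice,
          ModifiedJacobi.weierstrassZeta (ModifiedJacobi.periods τ).lattice (z + ω) =
            ModifiedJacobi.weierstrassZeta (ModifiedJacobi.periods τ).lattice z +
              ModifiedJacobi.weierstrassEta (ModifiedJacobi.periods τ) ω)) ∧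
    -- `σ(τ, z)` is a modified Jacobi form of weight `-1` and index `0` on `SL₂(ℤ)`
    ModifiedJacobi.sigma ∈ ModifiedJacobi.J (-1) (⊤ : Subgroup SL(2, ℤ)) ∧
    -- the Klein forms are its specializations, and they are nearly holomorphic modular forms
    (∀ (a b : ℝ) (τ : ℍ),
      ModifiedJacobi.slash'' (-1) ModifiedJacobi.sigma a b τ 0 =
        ModifiedJacobi.kleinForm a b τ) ∧
    (∀ (N : ℕ), 1 ≤ N → ∀ a b : ℤ,
      ModifiedJacobi.IsNearlyHolomorphicModularForm (-1) (CongruenceSubgroup.Gamma (2 * N ^ 2))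
        (ModifiedJacobi.kleinForm ((a : ℝ) / N) ((b : ℝ) / N))) :=
  ⟨⟨fun _ z => ModifiedJacobi.multipliable_sigmaFactor _ z,
      fun _ _ hω _ hz => ModifiedJacobi.weierstrassZeta_add hω hz⟩,
    ModifiedJacobi.sigma_mem_J, ModifiedJacobi.slash''_sigma_zero,
    fun _ hN a b => ModifiedJacobi.isNearlyHolomorphicModularForm_kleinForm hN a b⟩
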